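/- All functions below live on (parts of) the Riemann surface $\mathcal R$ of the logarithm; $S(d,\alpha)=\{z\in\mathcal R:|\arg z-d|<\alpha\pi/2\}$, $S(d,\alpha,r)=S(d,\alpha)\cap\{|z|<r\}$. A sectorial region $G(d,\alpha)$ is a domain $G\subset S(d,\alpha)$ such that for every $\beta\in(0,\alpha)$ there is $\rho>0$ with $S(d,\beta,\rho)\subset G$. Let $\mathbf M=(M_p)_{p\ge0}$ be a strongly regular sequence: $M_p>0$, $M_0=1$, $M_{p+1}^2\le M_pM_{p+2}$, there is $A>0$ with $M_{p+\ell}\le A^{p+\ell}M_pM_\ell$ for all $p,\ell$, and there is $B>0$ with $\sum_{\ell\ge p}\frac{M_\ell}{(\ell+1)M_{\ell+1}}\le B\frac{M_p}{M_{p+1}}$ for all $p$. Put $m_p=M_{p+1}/M_p$ and $h_{\mathbf M}(t)=\inf_{p\ge 0}M_pt^p$. The growth index $\gamma(\mathbf M)\in(0,\infty)$ is the supremum of the $\gamma>0$ for which there are $a\ge1$ and a real sequence $(m'_p)$ with $a^{-1}m_p\le m'_p\le am_p$ ($p\ge1$) and $((p+1)^{-\gamma}m'_p)_{p\ge0}$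 non-decreasing. Assume $\sum_{n\ge0}(M_n/M_{n+1})^{1/\gamma(\mathbf M)}=\infty$. Let $0<\delta<\delta_1<\gamma(\mathbf M)$ and $s\delta_1<1<s\gamma(\mathbf M)$. With $\mathbf M^s=(M_p^s)_p$, for $z\in S(0,\delta)$ let $$G_{\mathbf M}(z)=\exp\Big(\frac1\pi\int_{-\infty}^{\infty}\log\big(h_{\mathbf M^s}(|t|)\big)\frac{itz^s-1}{it-z^s}\frac{dt}{1+t^2}\Big),\qquad e_{\mathbf M}(z)=zG_{\mathbf M}(1/z),\qquad m(\lambda)=\int_0^\infty t^{\lambda-1}e_{\mathbf M}(t)\,dt .$$ Let $d\in\mathbb R$ and let $\hat f=\sum_{n\ge0}\frac{f_n}{n!}z^n$ be $\mathbf M$-summable in direction $d$ with respect to the kernel $e_{\mathbf M}$, in the following sense: (i) $(f_n)\in\Lambda_{\mathbf M}$, i.e. $|f_n|\le CA^nn!M_n$ for some $A,C>0$ and all $n$; (ii) for some $\varepsilon>0$ with $\gamma(\mathbf M)<\delta+\varepsilon$, the sum near $0$ of the formal $\mathbf M$-Borel transform $\sum_{n}\frac{f_n}{n!\,m(n)}z^n$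 continues analytically to a function $g$ on $S(d,\varepsilon)$ that has a limit at $0$ along each bounded proper subsector and satisfies, on each unbounded proper subsector $T$ of $S(d,\varepsilon)$, $|g(z)|\le k_4/h_{\mathbf M}(k_5/|z|)$ for $z\in T$, $|z|\ge r$, with constants $r,k_4,k_5>0$ depending on $T$. Then there are $\beta>\gamma(\mathbf M)$, a sectorial region $G=G(d,\beta)$ and a holomorphic function $f$ on $G$ such that: 1. $f$ is the $\mathbf M$-Laplace transform of $g$ in $G$. That is, put $(\mathcal L^\tau_{\mathbf M}g)(z)=\int_0^{\infty(\tau)}e_{\mathbf M}(u/z)g(u)\frac{du}{u}$, along the ray $\arg u=\tau$. For every $\tau$ with $|\tau-d|<\varepsilon\pi/2$ there is $r>0$ such that this integral converges absolutely whenever $|\arg z-\tau|<\delta\pi/2$ and $|z|<r$, and equals $f(z)$ if moreover $z\in G$; and each $z\in G$ admits a $\tau$ with $|\tau-d|<\varepsilon\pi/2$, $|\arg z-\tau|<\delta\pi/2$ for which the integral converges absolutely and equals $f(z)$. 2. $f\in\mathcal A_{\mathbf M}(G)$: there are $A,C>0$ with $|f^{(p)}(z)|\le CA^pp!M_p$ for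 all $p\ge0$ and $z\in G$. 3. $f\sim_{\mathbf M}\hat f$ in $G$: for every (bounded or unbounded) sector $T$ with $\overline T\setminus\{0\}\subset G$ there are $A,C>0$ with $\big|f(z)-\sum_{p=0}^{N-1}\frac{f_p}{p!}z^p\big|\le CA^NM_N|z|^N$ for all $N\ge1$ and $z\in T$. -/

import Mathlib

open Filter Topology MeasureTheory

noncomputable section

namespace MSummability

/-! The Riemann surface of the logarithm is represented by its global logarithmic coordinate:
`ζ : ℂ` stands for the point `z` with `|z| = exp (re ζ)` and `arg z = im ζ` (so that `ζ = log z`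
and `exp ζ` is the projection of `z` to the complex plane). Multiplication of points of the surface
is addition of coordinates, `z → 0` is `re ζ → -∞`, and a function is holomorphic on an open part
of the surface iff it is holomorphic as a function of `ζ`. -/

/-- `|z|` for the point `z` of the surface with coordinate `ζ`. -/
def modulus (ζ : ℂ) : ℝ := Real.exp ζ.re

/-- The unbounded sector `S(d, α) = {z : |arg z - d| < α π / 2}`. -/
def sector (d α : ℝ) : Set ℂ := {ζ | |ζ.im - d| < α * Real.pi / 2}

/-- The bounded sector `S(d, α, r) = {z : |arg z - d| < α π / 2, |z| < r}`. -/
def boundedSector (d α r : ℝ) : Set ℂ := {ζ | ζ ∈ sector d α ∧ modulus ζ < r}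

/-- `T` is a sector with vertex at the origin, of positive opening, bounded or unbounded. -/
def IsSector (T : Set ℂ) : Prop :=
  ∃ d α : ℝ, 0 < α ∧ (T = sector d α ∨ ∃ r : ℝ, 0 < r ∧ T = boundedSector d α r)

/-- The closed interval of arguments of a sector with data `(d', α')` lies in the open interval of
arguments of a sector with data `(d, α)`. -/
def ProperAperture (d' α' d α : ℝ) : Prop :=
  0 < α' ∧ d - α * Real.pi / 2 < d' - α' * Real.pi / 2 ∧
    d' + α' * Real.pi / 2 < d + α * Real.pi / 2

/-- `G` is a sectorial region `G(d, α)`. -/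
structure IsSectorialRegion (G : Set ℂ) (d α : ℝ) : Prop where
  isOpen : IsOpen G
  isConnected : IsConnected G
  subset : G ⊆ sector d α
  exists_radius : ∀ β : ℝ, 0 < β → β < α → ∃ ρ : ℝ, 0 < ρ ∧ boundedSector d β ρ ⊆ G

/-- The derivative `d/dz` on the surface, in the coordinate `ζ = log z`: `d/dz = exp (-ζ) d/dζ`. -/
def zDeriv (f : ℂ → ℂ) : ℂ → ℂ := fun ζ => Complex.exp (-ζ) * deriv f ζ

/-- Strongly regular sequences (normalised by `M 0 = 1`). -/
structure StronglyRegular (M : ℕ → ℝ) : Prop where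
  pos : ∀ p, 0 < M p
  zero : M 0 = 1
  logConvex : ∀ p, M (p + 1) ^ 2 ≤ M p * M (p + 2)
  moderateGrowth : ∃ A : ℝ, 0 < A ∧ ∀ p l : ℕ, M (p + l) ≤ A ^ (p + l) * M p * M l
  strongNonQuasianalytic : ∃ B : ℝ, 0 < B ∧ ∀ p : ℕ,
    Summable (fun j : ℕ => M (p + j) / (((p + j : ℕ) + 1 : ℝ) * M (p + j + 1))) ∧
    ∑' j : ℕ, M (p + j) / (((p + j : ℕ) + 1 : ℝ) * M (p + j + 1)) ≤ B * (M p / M (p + 1))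

/-- The quotients `m_p = M_{p+1} / M_p`. -/
def quotientSeq (M : ℕ → ℝ) (p : ℕ) : ℝ := M (p + 1) / M p

/-- Property `(P_γ)`. -/
def PropertyP (M : ℕ → ℝ) (γ : ℝ) : Prop :=
  ∃ (m' : ℕ → ℝ) (a : ℝ), 1 ≤ a ∧
    (∀ p : ℕ, 1 ≤ p → a⁻¹ * quotientSeq M p ≤ m' p ∧ m' p ≤ a * quotientSeq M p) ∧
    Monotone (fun p : ℕ => ((p : ℝ) + 1) ^ (-γ) * m' p)

/-- The growth index `γ(M)`. For a strongly regular sequence the set below is nonempty and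
bounded above. -/
def growthIndex (M : ℕ → ℝ) : ℝ := sSup {γ : ℝ | 0 < γ ∧ PropertyP M γ}

/-- `h_M(t) = inf_p M_p t^p`. -/
def hFun (M : ℕ → ℝ) (t : ℝ) : ℝ := ⨅ p : ℕ, M p * t ^ p

/-- The divergence condition `∑ (M_n / M_{n+1})^{1/γ(M)} = ∞`. -/
def WatsonCondition (M : ℕ → ℝ) : Prop :=
  ¬ Summable (fun n : ℕ => (M n / M (n + 1)) ^ (1 / growthIndex M))

/-- `(a_p) ∈ Λ_M`. -/
def MemLambda (M : ℕ → ℝ) (a : ℕ → ℂ) : Prop :=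
  ∃ A C : ℝ, 0 < A ∧ ∀ p : ℕ, ‖a p‖ ≤ C * (A ^ p * p.factorial * M p)

/-- `f ∈ 𝒜_M(G)`: `f` is holomorphic in `G` and, for some `A > 0`, the quotients
`|D^p f(z)| / (A^p p! M_p)` are bounded uniformly in `p` and `z ∈ G`. -/
def MemUltraholomorphic (M : ℕ → ℝ) (G : Set ℂ) (f : ℂ → ℂ) : Prop :=
  DifferentiableOn ℂ f G ∧ ∃ A C : ℝ, 0 < A ∧
    ∀ p : ℕ, ∀ ζ ∈ G, ‖(zDeriv^[p] f) ζ‖ ≤ C * (A ^ p * p.factorial * M p)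

/-- `f` admits the formal power series `F` as its uniform `M`-asymptotic expansion in `T`. -/
def UniformAsymptotic (M : ℕ → ℝ) (T : Set ℂ) (f : ℂ → ℂ) (F : PowerSeries ℂ) : Prop :=
  ∃ A C : ℝ, 0 < A ∧ 0 < C ∧ ∀ N : ℕ, 1 ≤ N → ∀ ζ ∈ T,
    ‖f ζ - ∑ p ∈ Finset.range N, PowerSeries.coeff p F * Complex.exp ζ ^ p‖
      ≤ C * A ^ N * M N * modulus ζ ^ N

/-- `f ∼_M F` in a sectorial region `G`: uniformly in every sector `T` whose closure, the origin
being removed, lies in `G`. (The origin is not a point of the surface, so that the closure in the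
coordinate `ζ` is the closure with the origin removed.) -/
def AsymptoticIn (M : ℕ → ℝ) (G : Set ℂ) (f : ℂ → ℂ) (F : PowerSeries ℂ) : Prop :=
  ∀ T : Set ℂ, IsSector T → closure T ⊆ G → UniformAsymptotic M T f F

/-- Admissible parameters for the kernel: `0 < δ < δ₁ < γ(M)` and `s δ₁ < 1 < s γ(M)`. -/
structure KernelParameters (M : ℕ → ℝ) (δ δ₁ s : ℝ) : Prop where
  pos : 0 < δ
  lt : δ < δ₁
  lt_growthIndex : δ₁ < growthIndex M
  mul_lt_one : s * δ₁ < 1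
  one_lt_mul : 1 < s * growthIndex M

/-- The flat function `G_M`,
`exp (π⁻¹ ∫ log h_{M^s}(|t|) (i t z^s - 1) / (i t - z^s) dt / (1 + t²))`. -/
def flatFun (M : ℕ → ℝ) (s : ℝ) (ζ : ℂ) : ℂ :=
  Complex.exp ((1 / Real.pi : ℂ) * ∫ t : ℝ,
    (Real.log (hFun (fun p => M p ^ s) |t|) : ℂ)
      * ((Complex.I * t * Complex.exp (s * ζ) - 1) / (Complex.I * t - Complex.exp (s * ζ)))
      * (1 / (1 + (t : ℂ) ^ 2)))

/-- The kernel `e_M(z) = z G_M(1/z)`. -/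
def kernel (M : ℕ → ℝ) (s : ℝ) (ζ : ℂ) : ℂ := Complex.exp ζ * flatFun M s (-ζ)

/-- The moment function `m(λ) = ∫_0^∞ t^{λ-1} e_M(t) dt`. -/
def moment (M : ℕ → ℝ) (s : ℝ) (lam : ℂ) : ℂ :=
  ∫ t in Set.Ioi (0 : ℝ), (t : ℂ) ^ (lam - 1) * kernel M s (Real.log t : ℂ)

/-- The formal `M`-Borel transform. -/
def formalBorel (M : ℕ → ℝ) (s : ℝ) (F : PowerSeries ℂ) : PowerSeries ℂ :=
  PowerSeries.mk fun p => PowerSeries.coeff p F / moment M s p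

/-- `g` is continuous at the origin in `S(d, α)`: it has a limit at the origin along each bounded
proper subsector. -/
def ContinuousAtOrigin (d α : ℝ) (g : ℂ → ℂ) : Prop :=
  ∀ d' α' r : ℝ, ProperAperture d' α' d α → 0 < r →
    ∃ l : ℂ, Tendsto g (comap Complex.re atBot ⊓ 𝓟 (boundedSector d' α' r)) (𝓝 l)

/-- `g ∈ 𝒜^{(M)}(S(d, α))`. -/
structure MemGrowthClass (M : ℕ → ℝ) (d α : ℝ) (g : ℂ → ℂ) : Prop where
  holomorphic : DifferentiableOn ℂ g (sector d α)
  continuousAtOrigin : ContinuousAtOrigin d α g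
  growth : ∀ d' α' : ℝ, ProperAperture d' α' d α →
    ∃ r k₄ k₅ : ℝ, 0 < r ∧ 0 < k₄ ∧ 0 < k₅ ∧ ∀ ζ ∈ sector d' α', r ≤ modulus ζ →
      ‖g ζ‖ ≤ k₄ / hFun M (k₅ / modulus ζ)

/-- The integrand of the `M`-Laplace transform in direction `τ` at the point `ζ`, on the path
`u = t e^{iτ}`, `du / u = dt / t`. -/
def laplaceIntegrand (M : ℕ → ℝ) (s τ : ℝ) (g : ℂ → ℂ) (ζ : ℂ) (t : ℝ) : ℂ :=
  kernel M s ((Real.log t + Complex.I * τ) - ζ) * g (Real.log t + Complex.I * τ) / t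

/-- The `M`-Laplace transform of `g` in direction `τ`. -/
def laplaceTransform (M : ℕ → ℝ) (s τ : ℝ) (g : ℂ → ℂ) (ζ : ℂ) : ℂ :=
  ∫ t in Set.Ioi (0 : ℝ), laplaceIntegrand M s τ g ζ t

/-- In `G`, the function `f` is the `M`-Laplace transform of `g ∈ 𝒜^{(M)}(S(d, α))`: it is glued
from the transforms of `g` in the directions `τ` with `|τ - d| < α π / 2`, the transform in
direction `τ` being considered at points `z` with `|arg z - τ| < δ π / 2`, where its integral
converges (absolutely) as soon as `|z|` is small enough. -/
structure IsLaplaceTransformIn (M : ℕ → ℝ) (δ s d α : ℝ) (g : ℂ → ℂ) (G : Set ℂ) (f : ℂ → ℂ) :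
    Prop where
  covers : ∀ ζ ∈ G, ∃ τ : ℝ, |τ - d| < α * Real.pi / 2 ∧ ζ ∈ sector τ δ ∧
    IntegrableOn (laplaceIntegrand M s τ g ζ) (Set.Ioi 0) ∧ f ζ = laplaceTransform M s τ g ζ
  agrees : ∀ τ : ℝ, |τ - d| < α * Real.pi / 2 → ∃ r : ℝ, 0 < r ∧ ∀ ζ ∈ boundedSector τ δ r,
    IntegrableOn (laplaceIntegrand M s τ g ζ) (Set.Ioi 0) ∧
      (ζ ∈ G → f ζ = laplaceTransform M s τ g ζ)

/-- The formal power series `F = ∑ (f_n / n!) z^n` is `M`-summable in direction `d`, with respect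
to the kernel `e_M` with parameters `(δ, δ₁, s)`, and `g`, in the sector `S(d, ε)`, is the analytic
continuation of its formal `M`-Borel transform. -/
structure MSummable (M : ℕ → ℝ) (δ δ₁ s d ε : ℝ) (F : PowerSeries ℂ) (g : ℂ → ℂ) : Prop where
  watson : WatsonCondition M
  kernelParameters : KernelParameters M δ δ₁ s
  memLambda : MemLambda M (fun n => (n.factorial : ℂ) * PowerSeries.coeff n F)
  eps_pos : 0 < ε
  continuation : ∃ R : ℝ, 0 < R ∧ ∀ ζ ∈ boundedSector d ε R,
    HasSum (fun p : ℕ => PowerSeries.coeff p (formalBorel M s F) * Complex.exp ζ ^ p) (g ζ)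
  memGrowthClass : MemGrowthClass M d ε g

end MSummability

end

/-! Everything reduces to one estimate of the kernel against the Taylor remainders of `g`, uniform
in `N`.

Since `1/s` lies below the growth index, `M p ≥ c ^ p * p! ^ σ` with `s * σ > 1`. Hence `log
h_{M^s}(|t|)` is `O(|t|^(-1/(sσ)))`, which is integrable at 0, and the integral defining the flat
function converges. Its real part is a Poisson integral in the half-plane of `w = z^s`. Keeping only
the part over `0 < t ≤ |w|` gives `|G_M(z)| ≤ h_M(K|z|)`, hence `|e_M(v)| ≤ |v| h_M(K/|v|)` for
`|arg v| < δπ/2`.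

The remainders of `g` are bounded by `C D^N |u|^N / h_M(k/|u|)` along the whole ray. By moderate
growth `h_M(t) ≤ h_M(At)²`, so the kernel at `u/z` supplies two factors `h_M(AK|z/u|)`. For `|z| <
k/(AK)` the first absorbs `1/h_M(k/|u|)`; the second, multiplied by `|u/z|^(N+1)`, is at most a
constant times `D^N M_N min(|u/z|, |z/u|)` (`exists_norm_kernel_mul_sub_sum_le`).

In the coordinate `log u` this decay is exponential on both sides. So Laplace integrals converge, do
not depend on the direction by Cauchy's theorem, and are holomorphic. As they send `u^p` to `m(p)
z^p`, integrating the estimate gives the asymptotic expansion with constants uniform on the region.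
Cauchy estimates on discs of radius proportional to `|z|` then bound the derivatives.

Directions within `επ/2` of `d`, each serving points within `δπ/2`, cover every opening below `δ +
ε`. Since this exceeds `γ(M)`, some `β > γ(M)` is available. -/

namespace MSummability

/-! ### Inequalities for `h_M`. -/

section InfimumFunction

variable {M : ℕ → ℝ}

theorem bddBelow_range_mul_pow (hM : ∀ p, 0 < M p) {t : ℝ} (ht : 0 ≤ t) :
    BddBelow (Set.range fun p : ℕ => M p * t ^ p) :=
  ⟨0, by rintro _ ⟨p, rfl⟩; have := (hM p).le; positivity⟩

theorem hFun_le (hM : ∀ p, 0 < M p) {t : ℝ} (ht : 0 ≤ t) (p : ℕ) : hFun M t ≤ M p * t ^ p :=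
  ciInf_le (bddBelow_range_mul_pow hM ht) p

theorem hFun_nonneg (hM : ∀ p, 0 < M p) {t : ℝ} (ht : 0 ≤ t) : 0 ≤ hFun M t :=
  le_ciInf fun p => by have := (hM p).le; positivity

theorem hFun_le_one (hM : ∀ p, 0 < M p) (h0 : M 0 = 1) {t : ℝ} (ht : 0 ≤ t) : hFun M t ≤ 1 := by
  simpa [h0] using hFun_le hM ht 0

theorem hFun_mono (hM : ∀ p, 0 < M p) {t u : ℝ} (ht : 0 ≤ t) (htu : t ≤ u) :
    hFun M t ≤ hFun M u :=
  le_ciInf fun p => (hFun_le hM ht p).trans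
    (mul_le_mul_of_nonneg_left (pow_le_pow_left₀ ht htu p) (hM p).le)

theorem hFun_rpow_le (hM : ∀ p, 0 < M p) {s t : ℝ} (hs : 0 < s) (ht : 0 ≤ t) :
    hFun (fun p => M p ^ s) (t ^ s) ≤ hFun M t ^ s := by
  have hMs : ∀ p, 0 < M p ^ s := fun p => Real.rpow_pos_of_pos (hM p) s
  have hts : 0 ≤ t ^ s := Real.rpow_nonneg ht s
  rw [← Real.rpow_inv_le_iff_of_pos (hFun_nonneg hMs hts) (hFun_nonneg hM ht) hs]
  refine le_ciInf fun p => ?_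
  have hMp := (hM p).le
  rw [Real.rpow_inv_le_iff_of_pos (hFun_nonneg hMs hts) (by positivity) hs]
  refine (hFun_le hMs hts p).trans_eq ?_
  rw [Real.mul_rpow hMp (by positivity), ← Real.rpow_natCast, ← Real.rpow_natCast,
    ← Real.rpow_mul ht, ← Real.rpow_mul ht, mul_comm s]

/-- Test the infimum on even indices only and split `M (p + p)` by moderate growth. -/
theorem hFun_le_sq (hM : ∀ p, 0 < M p) {A : ℝ} (hA : 0 < A)
    (hmg : ∀ p l : ℕ, M (p + l) ≤ A ^ (p + l) * M p * M l) {t : ℝ} (ht : 0 ≤ t) :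
    hFun M t ≤ hFun M (A * t) ^ 2 := by
  have hAt : 0 ≤ A * t := by positivity
  rw [← Real.sqrt_le_left (hFun_nonneg hM hAt)]
  refine le_ciInf fun p => ?_
  have hMp := (hM p).le
  rw [Real.sqrt_le_left (by positivity)]
  calc hFun M t ≤ M (p + p) * t ^ (p + p) := hFun_le hM ht _
    _ ≤ (A ^ (p + p) * M p * M p) * t ^ (p + p) :=
        mul_le_mul_of_nonneg_right (hmg p p) (by positivity)
    _ = (M p * (A * t) ^ p) ^ 2 := by ring

theorem exists_hFun_le_pow (hM : ∀ p, 0 < M p) {A : ℝ} (hA : 0 < A)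
    (hmg : ∀ p l : ℕ, M (p + l) ≤ A ^ (p + l) * M p * M l) (n : ℕ) {t : ℝ} (ht : 0 ≤ t) :
    hFun M t ≤ hFun M (A ^ n * t) ^ 2 ^ n := by
  induction n with
  | zero => simp
  | succ n ih =>
    have hAt : 0 ≤ A ^ n * t := by positivity
    calc hFun M t ≤ hFun M (A ^ n * t) ^ 2 ^ n := ih
      _ ≤ (hFun M (A * (A ^ n * t)) ^ 2) ^ 2 ^ n :=
          pow_le_pow_left₀ (hFun_nonneg hM hAt) (hFun_le_sq hM hA hmg hAt) _
      _ = hFun M (A ^ (n + 1) * t) ^ 2 ^ (n + 1) := by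
          rw [← pow_mul, pow_succ' 2, pow_succ' A, mul_assoc]

/-- A power of `h_M` costs only a dilation: iterate the squaring inequality until `2 ^ n * c ≥ 1`,
then use `h_M ≤ 1`. -/
theorem exists_hFun_rpow_le (hM : ∀ p, 0 < M p) (h0 : M 0 = 1) {A : ℝ} (hA : 0 < A)
    (hmg : ∀ p l : ℕ, M (p + l) ≤ A ^ (p + l) * M p * M l) {c : ℝ} (hc : 0 < c) :
    ∃ K : ℝ, 0 < K ∧ ∀ t : ℝ, 0 ≤ t → hFun M t ^ c ≤ hFun M (K * t) := by
  obtain ⟨n, hn⟩ := pow_unbounded_of_one_lt (1 / c) one_lt_two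
  refine ⟨A ^ n, by positivity, fun t ht => ?_⟩
  have hAt : 0 ≤ A ^ n * t := by positivity
  have hnn := hFun_nonneg hM hAt
  calc hFun M t ^ c ≤ (hFun M (A ^ n * t) ^ 2 ^ n) ^ c :=
        Real.rpow_le_rpow (hFun_nonneg hM ht) (exists_hFun_le_pow hM hA hmg n ht) hc.le
    _ = hFun M (A ^ n * t) ^ ((2 : ℝ) ^ n * c) := by
        rw [← Real.rpow_natCast, ← Real.rpow_mul hnn]; norm_num
    _ ≤ hFun M (A ^ n * t) ^ (1 : ℝ) := by
        refine Real.rpow_le_rpow_of_exponent_ge_of_imp hnn (hFun_le_one hM h0 hAt) ?_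
          (fun _ h => absurd h (by positivity))
        rw [div_lt_iff₀ hc] at hn
        exact hn.le
    _ = _ := Real.rpow_one _

/-- The inequality `y ^ p / p! ≤ exp y`, raised to the power `σ`, at the `y` with `y ^ σ = (c *
t)⁻¹`. -/
theorem exp_neg_le_hFun {c σ : ℝ} (hc : 0 < c) (hσ : 0 < σ)
    (hM : ∀ p : ℕ, c ^ p * (p.factorial : ℝ) ^ σ ≤ M p) {t : ℝ} (ht : 0 < t) :
    Real.exp (-(σ * (c * t) ^ (-σ⁻¹))) ≤ hFun M t := by
  refine le_ciInf fun p => ?_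
  set y : ℝ := (c * t) ^ (-σ⁻¹) with hy
  have hct : 0 < c * t := by positivity
  have hy0 : 0 < y := Real.rpow_pos_of_pos hct _
  have hyσ : y ^ σ = (c * t)⁻¹ := by
    rw [hy, ← Real.rpow_mul hct.le, neg_mul, inv_mul_cancel₀ hσ.ne', Real.rpow_neg_one]
  have hpf : (0 : ℝ) < p.factorial := by exact_mod_cast p.factorial_pos
  have h1 : y ^ p / p.factorial ≤ Real.exp y := Real.pow_div_factorial_le_exp y hy0.le p
  have h2 : Real.exp (-y) ≤ p.factorial / y ^ p := by
    rw [Real.exp_neg, ← inv_div]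
    exact inv_anti₀ (by positivity) h1
  calc Real.exp (-(σ * y)) = Real.exp (-y) ^ σ := by rw [← Real.exp_mul]; ring_nf
    _ ≤ (p.factorial / y ^ p) ^ σ := Real.rpow_le_rpow (Real.exp_pos _).le h2 hσ.le
    _ = c ^ p * (p.factorial : ℝ) ^ σ * t ^ p := by
        rw [Real.div_rpow hpf.le (by positivity), ← Real.rpow_natCast y, ← Real.rpow_mul hy0.le,
          mul_comm _ σ, Real.rpow_mul hy0.le, hyσ, Real.rpow_natCast, inv_pow, div_inv_eq_mul, mul_pow]
        ring
    _ ≤ M p * t ^ p := mul_le_mul_of_nonneg_right (hM p) (by positivity)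

theorem hFun_pos {c σ : ℝ} (hc : 0 < c) (hσ : 0 < σ)
    (hM : ∀ p : ℕ, c ^ p * (p.factorial : ℝ) ^ σ ≤ M p) {t : ℝ} (ht : 0 < t) : 0 < hFun M t :=
  (Real.exp_pos _).trans_le (exp_neg_le_hFun hc hσ hM ht)

theorem abs_log_hFun_le (hM : ∀ p, 0 < M p) (h0 : M 0 = 1) {c σ : ℝ} (hc : 0 < c) (hσ : 0 < σ)
    (hMc : ∀ p : ℕ, c ^ p * (p.factorial : ℝ) ^ σ ≤ M p) {t : ℝ} (ht : 0 < t) :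
    |Real.log (hFun M t)| ≤ σ * c ^ (-σ⁻¹) * t ^ (-σ⁻¹) := by
  rw [abs_of_nonpos (Real.log_nonpos (hFun_nonneg hM ht.le) (hFun_le_one hM h0 ht.le)), neg_le,
    mul_assoc, ← Real.mul_rpow hc.le ht.le, Real.le_log_iff_exp_le (hFun_pos hc hσ hMc ht)]
  exact exp_neg_le_hFun hc hσ hMc ht

theorem measurable_hFun : Measurable (hFun M) :=
  Measurable.iInf fun p => by fun_prop

end InfimumFunction

/-! ### Factorial lower bounds from the growth index. -/

section GrowthIndex

variable {M : ℕ → ℝ}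

theorem PropertyP.exists_le_quotientSeq (hM : ∀ p, 0 < M p) {γ : ℝ} (h : PropertyP M γ) :
    ∃ c : ℝ, 0 < c ∧ ∀ p : ℕ, c * ((p : ℝ) + 1) ^ γ ≤ quotientSeq M p := by
  obtain ⟨m', a, ha, hm', hmono⟩ := h
  have hq : ∀ p, 0 < quotientSeq M p := fun p => div_pos (hM _) (hM _)
  have ha0 : 0 < a := by linarith
  have h1 : 0 < m' 1 := (mul_pos (inv_pos.2 ha0) (hq 1)).trans_le (hm' 1 le_rfl).1
  -- The comparison with `m'` starts at `p = 1`, so `p = 0` enters the constant separately.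
  refine ⟨min (quotientSeq M 0) (a⁻¹ * ((2 : ℝ) ^ (-γ) * m' 1)), by have := hq 0; positivity,
    fun p => ?_⟩
  rcases Nat.eq_zero_or_pos p with rfl | hp
  · simp
  · have hpp : (0 : ℝ) < (p : ℝ) + 1 := by positivity
    have h2 : (2 : ℝ) ^ (-γ) * m' 1 ≤ ((p : ℝ) + 1) ^ (-γ) * m' p := by
      have := hmono hp
      norm_num at this ⊢
      simpa [one_add_one_eq_two] using this
    calc _ ≤ (a⁻¹ * ((2 : ℝ) ^ (-γ) * m' 1)) * ((p : ℝ) + 1) ^ γ :=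
          mul_le_mul_of_nonneg_right (min_le_right _ _) (by positivity)
      _ ≤ (a⁻¹ * (((p : ℝ) + 1) ^ (-γ) * m' p)) * ((p : ℝ) + 1) ^ γ := by gcongr
      _ = a⁻¹ * m' p := by
          rw [Real.rpow_neg hpp.le]
          have := Real.rpow_pos_of_pos hpp γ
          field_simp
      _ ≤ quotientSeq M p := by
          rw [inv_mul_le_iff₀ ha0]; exact (hm' p hp).2

theorem exists_factorial_rpow_le (hM : ∀ p, 0 < M p) (h0 : M 0 = 1) {γ : ℝ}
    (h : PropertyP M γ) :
    ∃ c : ℝ, 0 < c ∧ ∀ p : ℕ, c ^ p * (p.factorial : ℝ) ^ γ ≤ M p := by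
  obtain ⟨c, hc, hcq⟩ := h.exists_le_quotientSeq hM
  refine ⟨c, hc, fun p => ?_⟩
  induction p with
  | zero => simp [h0]
  | succ p ih =>
    have hq := hcq p
    rw [quotientSeq, le_div_iff₀ (hM p)] at hq
    rw [Nat.factorial_succ, Nat.cast_mul, Real.mul_rpow (by positivity) (by positivity), pow_succ]
    push_cast
    calc _ = (c * ((p : ℝ) + 1) ^ γ) * (c ^ p * (p.factorial : ℝ) ^ γ) := by ring
      _ ≤ (c * ((p : ℝ) + 1) ^ γ) * M p := mul_le_mul_of_nonneg_left ih (by positivity)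
      _ ≤ _ := hq

theorem exists_propertyP_of_lt_growthIndex {x : ℝ} (hx : 0 ≤ x) (h : x < growthIndex M) :
    ∃ γ : ℝ, x < γ ∧ PropertyP M γ := by
  have hne : {γ : ℝ | 0 < γ ∧ PropertyP M γ}.Nonempty := by
    by_contra hne
    rw [Set.not_nonempty_iff_eq_empty] at hne
    -- The default value `sSup ∅ = 0` contradicts `0 ≤ x < growthIndex M`.
    rw [growthIndex, hne, Real.sSup_empty] at h
    linarith
  obtain ⟨γ, hγ, hlt⟩ := exists_lt_of_lt_csSup hne h
  exact ⟨γ, hlt, hγ.2⟩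

end GrowthIndex

/-! ### Holomorphy of dominated parametric integrals. -/

section ParametricIntegral

/-- Cauchy's estimate turns a bound on `Φ` into one on its derivative, so only `Φ` itself has to be
dominated. -/
theorem differentiableAt_integral_of_norm_le {α : Type*} [MeasurableSpace α] {μ : Measure α}
    {Φ : ℂ → α → ℂ} {z₀ : ℂ} {r : ℝ} {B : α → ℝ} (hr : 0 < r)
    (hmeas : ∀ z ∈ Metric.ball z₀ r, AEStronglyMeasurable (Φ z) μ)
    (hdiff : ∀ a, DifferentiableOn ℂ (fun z => Φ z a) (Metric.ball z₀ r))
    (hB : ∀ a, ∀ z ∈ Metric.ball z₀ r, ‖Φ z a‖ ≤ B a) (hBi : Integrable B μ) :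
    DifferentiableAt ℂ (fun z => ∫ a, Φ z a ∂μ) z₀ := by
  have hz₀ : z₀ ∈ Metric.ball z₀ r := Metric.mem_ball_self hr
  have hd : ∀ a, ∀ z ∈ Metric.ball z₀ r, HasDerivAt (fun z => Φ z a) (deriv (fun z => Φ z a) z) z :=
    fun a z hz => ((hdiff a).differentiableAt (Metric.isOpen_ball.mem_nhds hz)).hasDerivAt
  have hsub : Metric.ball z₀ (r / 2) ⊆ Metric.ball z₀ r := Metric.ball_subset_ball (by linarith)
  have hF' : AEStronglyMeasurable (fun a => deriv (fun z => Φ z a) z₀) μ := by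
    -- The derivative is measurable as a limit of difference quotients; the `+ 2` keeps every
    -- increment below `r`.
    set h : ℕ → ℂ := fun n => ((r / (n + 2) : ℝ) : ℂ) with hh
    have hpos : ∀ n : ℕ, 0 < r / ((n : ℝ) + 2) := fun n => by positivity
    have hne : ∀ n, h n ≠ 0 := fun n => by
      simpa only [hh] using Complex.ofReal_ne_zero.2 (hpos n).ne'
    have hlim : Tendsto h atTop (𝓝[≠] 0) := by
      rw [tendsto_nhdsWithin_iff]
      refine ⟨?_, Eventually.of_forall hne⟩
      have h1 : Tendsto (fun n : ℕ => r / ((n : ℝ) + 2)) atTop (𝓝 0) :=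
        tendsto_const_nhds.div_atTop
          (tendsto_atTop_add_const_right _ _ tendsto_natCast_atTop_atTop)
      simpa [hh, Function.comp_def] using (Complex.continuous_ofReal.tendsto 0).comp h1
    refine aestronglyMeasurable_of_tendsto_ae atTop
      (f := fun n a => (h n)⁻¹ • (Φ (z₀ + h n) a - Φ z₀ a)) (fun n => ?_)
      (Eventually.of_forall fun a => (hd a z₀ hz₀).tendsto_slope_zero.comp hlim)
    refine AEStronglyMeasurable.const_smul ((hmeas (z₀ + h n) ?_).sub (hmeas _ hz₀)) (h n)⁻¹
    rw [Metric.mem_ball, dist_eq_norm, add_sub_cancel_left, hh, Complex.norm_real,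
      Real.norm_of_nonneg (hpos n).le, div_lt_iff₀ (by positivity)]
    have : (0 : ℝ) ≤ n := n.cast_nonneg
    nlinarith
  refine (hasDerivAt_integral_of_dominated_loc_of_deriv_le (F := Φ)
    (F' := fun z a => deriv (fun z => Φ z a) z) (bound := fun a => B a / (r / 3))
    (Metric.ball_mem_nhds z₀ (half_pos hr)) ?_ ?_ hF' ?_ (hBi.div_const _) ?_).2.differentiableAt
  · filter_upwards [Metric.ball_mem_nhds z₀ hr] with z hz using hmeas z hz
  · exact hBi.mono' (hmeas _ hz₀) (Eventually.of_forall fun a => hB a _ hz₀)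
  · refine Eventually.of_forall fun a z hz => ?_
    have hcl : Metric.closedBall z (r / 3) ⊆ Metric.ball z₀ r := fun y hy => by
      rw [Metric.mem_ball] at hz ⊢
      rw [Metric.mem_closedBall] at hy
      linarith [dist_triangle y z z₀]
    refine Complex.norm_deriv_le_of_forall_mem_sphere_norm_le (by positivity)
      (DifferentiableOn.diffContOnCl ((hdiff a).mono
        (Metric.closure_ball_subset_closedBall.trans hcl)))
      fun y hy => hB a y (hcl (Metric.sphere_subset_closedBall hy))
  · exact Eventually.of_forall fun a z hz => hd a z (hsub hz)

end ParametricIntegral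

/-! ### Cauchy's theorem on horizontal strips. -/

section ContourShift

theorem integrable_exp_neg_abs_sub (c : ℝ) : Integrable fun x : ℝ => Real.exp (-|x - c|) := by
  have h : Integrable fun x : ℝ => Real.exp (-|x|) := by
    rw [← integrableOn_univ, ← Set.Iic_union_Ioi (a := (0 : ℝ)), integrableOn_union]
    refine ⟨(integrableOn_exp_Iic 0).congr_fun (fun x hx => ?_) measurableSet_Iic,
      (integrableOn_exp_neg_Ioi 0).congr_fun (fun x hx => ?_) measurableSet_Ioi⟩
    · simp [abs_of_nonpos (Set.mem_Iic.1 hx)]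
    · simp [abs_of_pos (Set.mem_Ioi.1 hx)]
  exact h.comp_sub_right c

theorem integral_exp_neg_abs_sub (c : ℝ) : ∫ x : ℝ, Real.exp (-|x - c|) = 2 := by
  rw [integral_sub_right_eq_self (fun x : ℝ => Real.exp (-|x|)) c,
    integral_comp_abs (f := fun x => Real.exp (-x)), integral_exp_neg_Ioi_zero, mul_one]

theorem integrable_of_norm_le_exp {φ : ℂ → ℂ} {C c y : ℝ}
    (hφ : ∀ u : ℂ, u.im = y → DifferentiableAt ℂ φ u)
    (hb : ∀ u : ℂ, u.im = y → ‖φ u‖ ≤ C * Real.exp (-|u.re - c|)) :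
    Integrable fun x : ℝ => φ (x + y * Complex.I) := by
  refine ((integrable_exp_neg_abs_sub c).const_mul C).mono' ?_
    (Eventually.of_forall fun x => by simpa using hb (x + y * Complex.I) (by simp))
  refine Continuous.aestronglyMeasurable (continuous_iff_continuousAt.2 fun x => ?_)
  have h := (hφ (x + y * Complex.I) (by simp)).continuousAt
  exact ContinuousAt.comp (f := fun x : ℝ => (x + y * Complex.I : ℂ)) h (by fun_prop)

/-- Cauchy's theorem on rectangles, whose vertical sides contribute nothing in the limit. In the
logarithmic coordinate this rotates the ray of integration. -/
theorem integral_horizontal_eq {φ : ℂ → ℂ} {C c a b : ℝ}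
    (hφ : ∀ u : ℂ, u.im ∈ Set.uIcc a b → DifferentiableAt ℂ φ u)
    (hb : ∀ u : ℂ, u.im ∈ Set.uIcc a b → ‖φ u‖ ≤ C * Real.exp (-|u.re - c|)) :
    ∫ x : ℝ, φ (x + a * Complex.I) = ∫ x : ℝ, φ (x + b * Complex.I) := by
  have hint : ∀ y ∈ Set.uIcc a b, Tendsto (fun n : ℕ => ∫ x in (-(n : ℝ))..n,
      φ (x + y * Complex.I)) atTop (𝓝 (∫ x : ℝ, φ (x + y * Complex.I))) := fun y hy =>
    intervalIntegral_tendsto_integral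
      (integrable_of_norm_le_exp (fun u hu => hφ u (hu ▸ hy)) (fun u hu => hb u (hu ▸ hy)))
      (tendsto_neg_atBot_iff.2 tendsto_natCast_atTop_atTop) tendsto_natCast_atTop_atTop
  have hvert : ∀ σ : ℕ → ℝ, Tendsto (fun n => |σ n - c|) atTop atTop →
      Tendsto (fun n => ∫ y in a..b, φ (σ n + y * Complex.I)) atTop (𝓝 0) := fun σ hσ => by
    have h0 : Tendsto (fun n => C * Real.exp (-|σ n - c|) * |b - a|) atTop (𝓝 0) := by
      have := (Real.tendsto_exp_neg_atTop_nhds_zero.comp hσ).const_mul C |>.mul_const |b - a|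
      simpa using this
    refine squeeze_zero_norm (fun n => ?_) h0
    refine intervalIntegral.norm_integral_le_of_norm_le_const fun y hy => ?_
    simpa using hb (σ n + y * Complex.I) (by simpa using Set.uIoc_subset_uIcc hy)
  have htop : Tendsto (fun n : ℕ => |(n : ℝ) - c|) atTop atTop :=
    tendsto_abs_atTop_atTop.comp
      (tendsto_atTop_add_const_right _ (-c) tendsto_natCast_atTop_atTop)
  have hbot : Tendsto (fun n : ℕ => |-(n : ℝ) - c|) atTop atTop :=
    tendsto_abs_atBot_atTop.comp (tendsto_atBot_add_const_right _ (-c)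
      (tendsto_neg_atBot_iff.2 tendsto_natCast_atTop_atTop))
  have hrect : ∀ n : ℕ, (∫ x in (-(n : ℝ))..n, φ (x + a * Complex.I)) -
      (∫ x in (-(n : ℝ))..n, φ (x + b * Complex.I)) +
      Complex.I • (∫ y in a..b, φ (((n : ℝ) : ℂ) + y * Complex.I)) -
      Complex.I • (∫ y in a..b, φ ((-(n : ℝ) : ℝ) + y * Complex.I)) = 0 := fun n => by
    have := Complex.integral_boundary_rect_eq_zero_of_differentiableOn φ
      ⟨-(n : ℝ), a⟩ ⟨n, b⟩ fun u hu => (hφ u hu.2).differentiableWithinAt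
    simpa using this
  have hlim := (((hint a Set.left_mem_uIcc).sub (hint b Set.right_mem_uIcc)).add
    ((hvert _ htop).const_smul Complex.I)).sub ((hvert _ hbot).const_smul Complex.I)
  simp_rw [hrect] at hlim
  have := tendsto_nhds_unique hlim tendsto_const_nhds
  simpa [sub_eq_zero] using this

end ContourShift

/-! ### The substitution `t = exp x`. -/

section ExponentialSubstitution

theorem image_exp_univ : Real.exp '' Set.univ = Set.Ioi 0 := by
  rw [Set.image_univ, Real.range_exp]

theorem integral_Ioi_eq_integral_exp (f : ℝ → ℂ) :
    ∫ t in Set.Ioi (0 : ℝ), f t = ∫ x : ℝ, (Real.exp x : ℂ) * f (Real.exp x) := by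
  rw [← image_exp_univ, integral_image_eq_integral_abs_deriv_smul MeasurableSet.univ
    (fun x _ => (Real.hasDerivAt_exp x).hasDerivWithinAt) Real.exp_injective.injOn,
    Measure.restrict_univ]
  simp [abs_of_pos (Real.exp_pos _)]

theorem integrableOn_Ioi_iff_integrable_exp (f : ℝ → ℂ) :
    IntegrableOn f (Set.Ioi 0) ↔ Integrable fun x : ℝ => (Real.exp x : ℂ) * f (Real.exp x) := by
  rw [← image_exp_univ, integrableOn_image_iff_integrableOn_abs_deriv_smul MeasurableSet.univ
    (fun x _ => (Real.hasDerivAt_exp x).hasDerivWithinAt) Real.exp_injective.injOn,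
    integrableOn_univ]
  simp [abs_of_pos (Real.exp_pos _)]

end ExponentialSubstitution

/-! ### Herglotz integrals in the right half-plane. -/

section Herglotz

/-- The integrand of the Herglotz integral in the right half-plane with boundary data `ℓ`. -/
noncomputable def herglotzIntegrand (ℓ : ℝ → ℝ) (w : ℂ) (t : ℝ) : ℂ :=
  (ℓ t : ℂ) * ((Complex.I * t * w - 1) / (Complex.I * t - w)) * (1 / (1 + (t : ℂ) ^ 2))

variable {ℓ : ℝ → ℝ}

theorem re_le_norm_I_mul_sub (w : ℂ) (t : ℝ) : w.re ≤ ‖Complex.I * t - w‖ := by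
  have := Complex.abs_re_le_norm (Complex.I * t - w)
  simp only [Complex.sub_re, Complex.mul_re, Complex.I_re, Complex.ofReal_re, Complex.I_im,
    Complex.ofReal_im] at this
  have h2 := neg_abs_le (0 * t - 1 * 0 - w.re)
  linarith

theorem I_mul_sub_ne_zero {w : ℂ} (hw : 0 < w.re) (t : ℝ) : Complex.I * t - w ≠ 0 :=
  norm_pos_iff.1 (hw.trans_le (re_le_norm_I_mul_sub w t))

theorem one_div_one_add_sq (t : ℝ) : 1 / (1 + (t : ℂ) ^ 2) = ((1 / (1 + t ^ 2) : ℝ) : ℂ) := by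
  push_cast; rfl

theorem norm_herglotzIntegrand_le {w : ℂ} {R u : ℝ} (hu : 0 < u) (hw : u ≤ w.re) (hR : ‖w‖ ≤ R)
    (t : ℝ) :
    ‖herglotzIntegrand ℓ w t‖ ≤ (R + (R ^ 2 + 1) / u) * |ℓ t * (1 + t ^ 2)⁻¹| := by
  have hd := re_le_norm_I_mul_sub w t
  have hd0 : 0 < ‖Complex.I * t - w‖ := by linarith
  have hne := I_mul_sub_ne_zero (hu.trans_le hw) t
  have h1 : (Complex.I * t * w - 1) / (Complex.I * t - w)
      = w + (w ^ 2 - 1) / (Complex.I * t - w) := by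
    field_simp; ring
  have h2 : ‖(Complex.I * t * w - 1) / (Complex.I * t - w)‖ ≤ R + (R ^ 2 + 1) / u := by
    rw [h1]
    refine (norm_add_le _ _).trans (add_le_add hR ?_)
    rw [norm_div]
    refine div_le_div₀ (by positivity) ((norm_sub_le _ _).trans ?_) hu (hw.trans hd)
    rw [norm_pow, norm_one]
    gcongr
  rw [herglotzIntegrand, one_div_one_add_sq, norm_mul, norm_mul, Complex.norm_real,
    Complex.norm_real, abs_mul, one_div, Real.norm_eq_abs, Real.norm_eq_abs]
  calc _ = ‖(Complex.I * t * w - 1) / (Complex.I * t - w)‖ * (|ℓ t| * |(1 + t ^ 2)⁻¹|) := by ring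
    _ ≤ _ := mul_le_mul_of_nonneg_right h2 (by positivity)

/-- The factor `1 / (1 + t ^ 2)` cancels in the real part, leaving the Poisson kernel. -/
theorem re_herglotzIntegrand {w : ℂ} (hw : 0 < w.re) (t : ℝ) :
    (herglotzIntegrand ℓ w t).re = ℓ t * (w.re / ‖Complex.I * t - w‖ ^ 2) := by
  have hne : Complex.normSq (Complex.I * t - w) ≠ 0 :=
    (Complex.normSq_pos.2 (I_mul_sub_ne_zero hw t)).ne'
  have ht : (1 + t ^ 2) ≠ 0 := by positivity
  rw [herglotzIntegrand, one_div_one_add_sq, mul_assoc, Complex.re_ofReal_mul, mul_comm (_ / _),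
    Complex.re_ofReal_mul, ← Complex.normSq_eq_norm_sq, Complex.div_re]
  have hN : Complex.normSq (Complex.I * t - w) = w.re ^ 2 + (t - w.im) ^ 2 := by
    simp [Complex.normSq_apply]; ring
  rw [hN] at hne ⊢
  simp only [Complex.sub_re, Complex.mul_re, Complex.I_re, Complex.ofReal_re, Complex.I_im,
    Complex.ofReal_im, Complex.one_re, Complex.sub_im, Complex.mul_im, Complex.one_im]
  field_simp
  ring

theorem measurable_herglotzIntegrand (hℓ : Measurable ℓ) (w : ℂ) :
    Measurable (herglotzIntegrand ℓ w) := by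
  unfold herglotzIntegrand
  fun_prop

theorem integrable_herglotzIntegrand (hℓ : Measurable ℓ)
    (hi : Integrable fun t => ℓ t * (1 + t ^ 2)⁻¹) {w : ℂ} (hw : 0 < w.re) :
    Integrable (herglotzIntegrand ℓ w) :=
  (hi.abs.const_mul _).mono' (measurable_herglotzIntegrand hℓ w).aestronglyMeasurable
    (Eventually.of_forall fun t => norm_herglotzIntegrand_le hw le_rfl le_rfl t)

theorem differentiableAt_integral_herglotzIntegrand (hℓ : Measurable ℓ)
    (hi : Integrable fun t => ℓ t * (1 + t ^ 2)⁻¹) {w₀ : ℂ} (hw₀ : 0 < w₀.re) :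
    DifferentiableAt ℂ (fun w => ∫ t, herglotzIntegrand ℓ w t) w₀ := by
  have hre : ∀ w ∈ Metric.ball w₀ (w₀.re / 2), w₀.re / 2 ≤ w.re := fun w hw => by
    have h1 := Complex.abs_re_le_norm (w - w₀)
    rw [Metric.mem_ball, dist_eq_norm] at hw
    have h2 := neg_abs_le (w - w₀).re
    rw [Complex.sub_re] at h1 h2
    linarith
  refine differentiableAt_integral_of_norm_le (half_pos hw₀)
    (fun w _ => (measurable_herglotzIntegrand hℓ w).aestronglyMeasurable) (fun t w hw => ?_)
    (fun t w hw => norm_herglotzIntegrand_le (half_pos hw₀) (hre w hw)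
      (R := ‖w₀‖ + w₀.re / 2) ?_ t) (hi.abs.const_mul _)
  · have hne := I_mul_sub_ne_zero ((half_pos hw₀).trans_le (hre w hw)) t
    unfold herglotzIntegrand
    exact (DifferentiableAt.mul (DifferentiableAt.mul (by fun_prop)
      (DifferentiableAt.div (by fun_prop) (by fun_prop) hne))
      (by fun_prop)).differentiableWithinAt
  · rw [Metric.mem_ball, dist_eq_norm] at hw
    linarith [norm_le_norm_add_norm_sub' w w₀]

/-- The Poisson integrand is nonpositive, so all but `0 < t ≤ ‖w‖` may be dropped. There `‖I * t -
w‖ ≤ 2 * ‖w‖`, and the interval has length `‖w‖`. -/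
theorem re_integral_herglotzIntegrand_le (hℓ : Measurable ℓ)
    (hi : Integrable fun t => ℓ t * (1 + t ^ 2)⁻¹) (hneg : ∀ t, ℓ t ≤ 0) {w : ℂ} (hw : 0 < w.re)
    {L : ℝ} (hL : L ≤ 0) (hLt : ∀ t ∈ Set.Ioc 0 ‖w‖, ℓ t ≤ L) :
    (∫ t, herglotzIntegrand ℓ w t).re ≤ L * (w.re / (4 * ‖w‖)) := by
  have hint := integrable_herglotzIntegrand hℓ hi hw
  have hw0 : 0 < ‖w‖ := hw.trans_le (Complex.re_le_norm w)
  have hre : (∫ t, herglotzIntegrand ℓ w t).re = ∫ t, (herglotzIntegrand ℓ w t).re :=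
    (Complex.reCLM.integral_comp_comm hint).symm
  rw [hre]
  have hmono : ∀ t, (herglotzIntegrand ℓ w t).re ≤
      (Set.Ioc 0 ‖w‖).indicator (fun _ => L * (w.re / (4 * ‖w‖ ^ 2))) t := fun t => by
    rw [re_herglotzIntegrand hw]
    have hd0 : 0 < ‖Complex.I * t - w‖ := norm_pos_iff.2 (I_mul_sub_ne_zero hw t)
    by_cases ht : t ∈ Set.Ioc 0 ‖w‖
    · rw [Set.indicator_of_mem ht]
      have hd : ‖Complex.I * t - w‖ ≤ 2 * ‖w‖ := by
        refine (norm_sub_le _ _).trans ?_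
        rw [norm_mul, Complex.norm_I, one_mul, Complex.norm_real, Real.norm_of_nonneg ht.1.le]
        linarith [ht.2]
      have hP : w.re / (4 * ‖w‖ ^ 2) ≤ w.re / ‖Complex.I * t - w‖ ^ 2 := by
        refine div_le_div_of_nonneg_left hw.le (by positivity) ?_
        nlinarith
      calc _ ≤ L * (w.re / ‖Complex.I * t - w‖ ^ 2) :=
            mul_le_mul_of_nonneg_right (hLt t ht) (by positivity)
        _ ≤ _ := mul_le_mul_of_nonpos_left hP hL
    · rw [Set.indicator_of_notMem ht]
      exact mul_nonpos_of_nonpos_of_nonneg (hneg t) (by positivity)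
  refine (integral_mono hint.re ?_ hmono).trans_eq ?_
  · exact (integrable_indicator_iff measurableSet_Ioc).2 (integrableOn_const (by simp) enorm_ne_top)
  · rw [integral_indicator measurableSet_Ioc, setIntegral_const]
    simp only [Measure.real, Real.volume_Ioc, sub_zero, ENNReal.toReal_ofReal hw0.le, smul_eq_mul]
    field_simp

/-- At real points conjugation amounts to `t ↦ -t`. This makes the kernel positive on the positive
axis. -/
theorem integral_herglotzIntegrand_ofReal (heven : ∀ t, ℓ (-t) = ℓ t) (x : ℝ) :
    ∃ y : ℝ, ∫ t, herglotzIntegrand ℓ x t = y := by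
  have hconj : ∀ t, (starRingEnd ℂ) (herglotzIntegrand ℓ x t) = herglotzIntegrand ℓ x (-t) :=
    fun t => by
      simp [herglotzIntegrand, heven]
  have h : (starRingEnd ℂ) (∫ t, herglotzIntegrand ℓ x t) = ∫ t, herglotzIntegrand ℓ x t := by
    rw [← integral_conj]
    simp_rw [hconj]
    exact integral_neg_eq_self (fun t => herglotzIntegrand ℓ x t) volume
  exact (Complex.conj_eq_iff_real.1 h)

end Herglotz

/-! ### Convergence and flatness of `G_M`. -/

section FlatFunction

variable {M : ℕ → ℝ}

theorem integrable_rpow_abs_mul_inv_one_add_sq {a : ℝ} (ha0 : 0 ≤ a) (ha1 : a < 1) :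
    Integrable fun t : ℝ => |t| ^ (-a) * (1 + t ^ 2)⁻¹ := by
  have hpos : IntegrableOn (fun t : ℝ => |t| ^ (-a) * (1 + t ^ 2)⁻¹) (Set.Ioi 0) := by
    rw [← Set.Ioc_union_Ioi_eq_Ioi zero_le_one, integrableOn_union]
    have hm : Measurable fun t : ℝ => |t| ^ (-a) * (1 + t ^ 2)⁻¹ := by fun_prop
    constructor
    · have h := (intervalIntegral.intervalIntegrable_rpow' (a := 0) (b := 1)
        (show -1 < -a by linarith)).1
      refine Integrable.mono' h hm.aestronglyMeasurable ?_
      refine (ae_restrict_mem measurableSet_Ioc).mono fun t ht => ?_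
      have : 0 < t := ht.1
      rw [Real.norm_of_nonneg (by positivity), abs_of_pos this]
      refine mul_le_of_le_one_right (by positivity) (inv_le_one_of_one_le₀ ?_)
      nlinarith
    · refine Integrable.mono' integrable_inv_one_add_sq.integrableOn hm.aestronglyMeasurable ?_
      refine (ae_restrict_mem measurableSet_Ioi).mono fun t ht => ?_
      have h1 : (1 : ℝ) < t := ht
      rw [Real.norm_of_nonneg (by positivity), abs_of_pos (by linarith)]
      exact mul_le_of_le_one_left (by positivity)
        (Real.rpow_le_one_of_one_le_of_nonpos h1.le (by linarith))
  rw [← integrableOn_univ, ← Set.Iic_union_Ioi (a := (0 : ℝ)), integrableOn_union]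
  refine ⟨?_, hpos⟩
  rw [integrableOn_Iic_iff_integrableOn_Iio]
  have h2 := (Measure.measurePreserving_neg (volume : Measure ℝ)).integrableOn_comp_preimage
    (Homeomorph.neg ℝ).measurableEmbedding (f := fun t : ℝ => |t| ^ (-a) * (1 + t ^ 2)⁻¹)
    (s := Set.Ioi 0)
  simpa [Function.comp_def] using h2.2 hpos

/-- The boundary data of the flat function. -/
noncomputable def logWeight (M : ℕ → ℝ) (s t : ℝ) : ℝ := Real.log (hFun (fun p => M p ^ s) |t|)

theorem flatFun_eq (s : ℝ) (ζ : ℂ) :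
    flatFun M s ζ = Complex.exp ((1 / Real.pi : ℂ) *
      ∫ t, herglotzIntegrand (logWeight M s) (Complex.exp (s * ζ)) t) := rfl

theorem measurable_logWeight (s : ℝ) : Measurable (logWeight M s) :=
  Real.measurable_log.comp (measurable_hFun.comp measurable_norm)

theorem logWeight_nonpos (hM : ∀ p, 0 < M p) (h0 : M 0 = 1) (s t : ℝ) : logWeight M s t ≤ 0 := by
  have hMs : ∀ p, 0 < M p ^ s := fun p => Real.rpow_pos_of_pos (hM p) s
  exact Real.log_nonpos (hFun_nonneg hMs (abs_nonneg t))
    (hFun_le_one hMs (by simp [h0]) (abs_nonneg t))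

theorem integrable_logWeight (hM : ∀ p, 0 < M p) (h0 : M 0 = 1) {s c σ : ℝ} (hc : 0 < c)
    (hσ : 1 < σ) (hMc : ∀ p : ℕ, c ^ p * (p.factorial : ℝ) ^ σ ≤ M p ^ s) :
    Integrable fun t => logWeight M s t * (1 + t ^ 2)⁻¹ := by
  have hMs : ∀ p, 0 < M p ^ s := fun p => Real.rpow_pos_of_pos (hM p) s
  have hσ0 : 0 < σ := by linarith
  have hσ1 : σ⁻¹ < 1 := inv_lt_one_of_one_lt₀ hσ
  refine ((integrable_rpow_abs_mul_inv_one_add_sq (inv_nonneg.2 hσ0.le) hσ1).const_mul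
    (σ * c ^ (-σ⁻¹))).mono' ((measurable_logWeight s).mul (by fun_prop)).aestronglyMeasurable ?_
  have h0' : ∀ᵐ t : ℝ, t ≠ 0 := by
    simp [ae_iff]
  filter_upwards [h0'] with t ht
  rw [norm_mul, Real.norm_eq_abs, Real.norm_of_nonneg (r := (1 + t ^ 2)⁻¹) (by positivity),
    ← mul_assoc]
  exact mul_le_mul_of_nonneg_right (abs_log_hFun_le hMs (by simp [h0]) hc hσ0 hMc
    (abs_pos.2 ht)) (by positivity)

theorem exp_mul_re_pos {s : ℝ} {ζ : ℂ} (hζ : |s * ζ.im| < Real.pi / 2) :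
    0 < (Complex.exp (s * ζ)).re := by
  rw [Complex.exp_re]
  have := Real.cos_pos_of_mem_Ioo (abs_lt.1 hζ)
  simp only [Complex.re_ofReal_mul, Complex.im_ofReal_mul]
  positivity

theorem differentiableAt_flatFun {s : ℝ} (hi : Integrable fun t => logWeight M s t * (1 + t ^ 2)⁻¹)
    {ζ : ℂ} (hζ : |s * ζ.im| < Real.pi / 2) : DifferentiableAt ℂ (flatFun M s) ζ := by
  have h1 := differentiableAt_integral_herglotzIntegrand (measurable_logWeight s) hi
    (exp_mul_re_pos hζ)
  have h2 : DifferentiableAt ℂ (fun ζ : ℂ => Complex.exp (s * ζ)) ζ := by fun_prop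
  exact ((h1.comp ζ h2).const_mul _).cexp

/-- With `w = z^s`, the ratio `w.re / ‖w‖` is at least `cos θ`. The Poisson bound gives a power of
`h_{M^s}(|z|^s)`, hence of `h_M(|z|)`, and the power is traded for a dilation. -/
theorem exists_norm_flatFun_le (hM : StronglyRegular M) {s θ : ℝ} (hs : 0 < s)
    (hθ : θ < Real.pi / 2) (hpos : ∀ t, 0 < t → 0 < hFun (fun p => M p ^ s) t)
    (hi : Integrable fun t => logWeight M s t * (1 + t ^ 2)⁻¹) :
    ∃ K : ℝ, 0 < K ∧ ∀ ζ : ℂ, |s * ζ.im| ≤ θ →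
      ‖flatFun M s ζ‖ ≤ hFun M (K * Real.exp ζ.re) := by
  by_cases hθ0 : 0 ≤ θ
  swap
  · exact ⟨1, one_pos, fun ζ hζ => absurd ((abs_nonneg _).trans hζ) hθ0⟩
  obtain ⟨A, hA, hmg⟩ := hM.moderateGrowth
  have hMs : ∀ p, 0 < M p ^ s := fun p => Real.rpow_pos_of_pos (hM.pos p) s
  have hcos : 0 < Real.cos θ := Real.cos_pos_of_mem_Ioo ⟨by linarith [Real.pi_pos], hθ⟩
  set c : ℝ := Real.cos θ / (4 * Real.pi) with hc
  have hc0 : 0 < c := by have := Real.pi_pos; positivity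
  obtain ⟨K, hK, hKt⟩ := exists_hFun_rpow_le hM.pos hM.zero hA hmg (mul_pos hs hc0)
  refine ⟨K, hK, fun ζ hζ => (?_ : _ ≤ _).trans (hKt _ (Real.exp_pos _).le)⟩
  have hre := exp_mul_re_pos (hζ.trans_lt hθ)
  set w := Complex.exp (s * ζ) with hw
  have hwn : ‖w‖ = Real.exp ζ.re ^ s := by
    rw [hw, Complex.norm_exp, Complex.re_ofReal_mul, ← Real.exp_mul, mul_comm]
  have hw0 : 0 < ‖w‖ := by rw [hwn]; positivity
  have hratio : Real.cos θ / 4 ≤ w.re / (4 * ‖w‖) := by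
    have : w.re = ‖w‖ * Real.cos (s * ζ.im) := by
      rw [hw, Complex.exp_re, Complex.norm_exp, Complex.im_ofReal_mul]
    have h2 : Real.cos θ ≤ Real.cos (s * ζ.im) := by
      rw [← Real.cos_abs (s * ζ.im)]
      exact Real.cos_le_cos_of_nonneg_of_le_pi (abs_nonneg _) (by linarith) hζ
    rw [this]
    field_simp
    exact h2
  set L := Real.log (hFun (fun p => M p ^ s) ‖w‖) with hLdef
  have hL : L ≤ 0 := by
    have := logWeight_nonpos hM.pos hM.zero s ‖w‖
    rwa [logWeight, abs_of_pos hw0] at this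
  have hle := re_integral_herglotzIntegrand_le (measurable_logWeight s) hi
    (logWeight_nonpos hM.pos hM.zero s) hre hL fun t ht => by
      rw [logWeight, abs_of_pos ht.1]
      exact Real.log_le_log (hpos t ht.1) (hFun_mono hMs ht.1.le ht.2)
  have hle2 := hle.trans (mul_le_mul_of_nonpos_left hratio hL)
  have hpi : (1 / Real.pi : ℂ) = ((1 / Real.pi : ℝ) : ℂ) := by push_cast; rfl
  have hh : 0 < hFun (fun p => M p ^ s) ‖w‖ := hpos _ hw0
  rw [flatFun_eq, Complex.norm_exp, hpi, Complex.re_ofReal_mul, ← hw]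
  calc Real.exp (1 / Real.pi * (∫ t, herglotzIntegrand (logWeight M s) w t).re)
      ≤ Real.exp (1 / Real.pi * (L * (Real.cos θ / 4))) := by
        have := Real.pi_pos
        gcongr
    _ = hFun (fun p => M p ^ s) ‖w‖ ^ c := by
        rw [Real.rpow_def_of_pos hh, hc, ← hLdef]
        congr 1
        have := Real.pi_pos
        field_simp
    _ ≤ (hFun M (Real.exp ζ.re) ^ s) ^ c := by
        rw [hwn]
        refine Real.rpow_le_rpow (hFun_nonneg hMs (by positivity))
          (hFun_rpow_le hM.pos hs (Real.exp_pos _).le) hc0.le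
    _ = hFun M (Real.exp ζ.re) ^ (s * c) := by
        rw [Real.rpow_mul (hFun_nonneg hM.pos (Real.exp_pos _).le)]

theorem kernel_ofReal (s x : ℝ) : ∃ y : ℝ, 0 < y ∧ kernel M s x = y := by
  obtain ⟨y, hy⟩ := integral_herglotzIntegrand_ofReal (ℓ := logWeight M s)
    (fun t => by simp [logWeight]) (Real.exp (s * (-x)))
  refine ⟨Real.exp x * Real.exp (1 / Real.pi * y), by positivity, ?_⟩
  rw [kernel, flatFun_eq]
  have : Complex.exp ((s : ℂ) * (-(x : ℂ))) = ((Real.exp (s * (-x)) : ℝ) : ℂ) := by push_cast; rfl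
  rw [this, hy]
  push_cast
  rfl

end FlatFunction

/-! ### Bounds for the kernel. -/

section Kernel

variable {M : ℕ → ℝ} {δ δ₁ s : ℝ}

theorem KernelParameters.s_pos (hk : KernelParameters M δ δ₁ s) : 0 < s := by
  have hγ : 0 < growthIndex M := (hk.pos.trans hk.lt).trans hk.lt_growthIndex
  have := hk.one_lt_mul
  by_contra hs
  nlinarith

theorem KernelParameters.exists_factorial_rpow_le (hM : StronglyRegular M)
    (hk : KernelParameters M δ δ₁ s) :
    ∃ c σ : ℝ, 0 < c ∧ 1 < s * σ ∧ ∀ p : ℕ, c ^ p * (p.factorial : ℝ) ^ σ ≤ M p := by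
  have hs := hk.s_pos
  obtain ⟨γ, hγ, hP⟩ := exists_propertyP_of_lt_growthIndex (M := M) (x := 1 / s)
    (by positivity) (by rw [div_lt_iff₀' hs]; exact hk.one_lt_mul)
  obtain ⟨c, hc, h⟩ := MSummability.exists_factorial_rpow_le hM.pos hM.zero hP
  exact ⟨c, γ, hc, by rwa [div_lt_iff₀' hs] at hγ, h⟩

theorem KernelParameters.hFun_pos (hM : StronglyRegular M) (hk : KernelParameters M δ δ₁ s)
    {t : ℝ} (ht : 0 < t) : 0 < hFun M t := by
  obtain ⟨c, σ, hc, hσ, h⟩ := hk.exists_factorial_rpow_le hM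
  have hs := hk.s_pos
  exact MSummability.hFun_pos hc (pos_of_mul_pos_right (one_pos.trans hσ) hs.le) h ht

theorem KernelParameters.exists_kernel_bound (hM : StronglyRegular M)
    (hk : KernelParameters M δ δ₁ s) :
    (∀ v : ℂ, |v.im| < δ * Real.pi / 2 → DifferentiableAt ℂ (kernel M s) v) ∧
    ∃ K : ℝ, 0 < K ∧ ∀ v : ℂ, |v.im| < δ * Real.pi / 2 →
      ‖kernel M s v‖ ≤ Real.exp v.re * hFun M (K * Real.exp (-v.re)) := by
  have hs := hk.s_pos
  obtain ⟨c, σ, hc, hσ, h⟩ := hk.exists_factorial_rpow_le hM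
  have hMs : ∀ p : ℕ, (c ^ s) ^ p * (p.factorial : ℝ) ^ (s * σ) ≤ M p ^ s := fun p => by
    have := Real.rpow_le_rpow (by positivity) (h p) hs.le
    rwa [Real.mul_rpow (by positivity) (by positivity), ← Real.rpow_natCast, ← Real.rpow_mul hc.le,
      ← Real.rpow_mul (by positivity), mul_comm (p : ℝ), Real.rpow_mul hc.le, Real.rpow_natCast,
      mul_comm σ] at this
  have hcs : 0 < c ^ s := by positivity
  have hi := integrable_logWeight hM.pos hM.zero hcs hσ hMs
  have hθ : s * (δ * Real.pi / 2) < Real.pi / 2 := by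
    have h1 : s * δ < 1 := (mul_lt_mul_of_pos_left hk.lt hs).trans hk.mul_lt_one
    have := Real.pi_pos
    nlinarith
  have him : ∀ v : ℂ, |v.im| < δ * Real.pi / 2 → |s * (-v).im| ≤ s * (δ * Real.pi / 2) :=
    fun v hv => by
      rw [abs_mul, abs_of_pos hs, Complex.neg_im, abs_neg]
      exact mul_le_mul_of_nonneg_left hv.le hs.le
  obtain ⟨K, hK, hb⟩ := exists_norm_flatFun_le hM hs hθ
    (fun t ht => MSummability.hFun_pos hcs (one_pos.trans hσ) hMs ht) hi
  refine ⟨fun v hv => ?_, K, hK, fun v hv => ?_⟩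
  · have h1 := differentiableAt_flatFun hi ((him v hv).trans_lt hθ)
    exact DifferentiableAt.mul (by fun_prop) (h1.comp v differentiable_neg.differentiableAt)
  · rw [kernel, norm_mul, Complex.norm_exp]
    have := hb (-v) (him v hv)
    rw [Complex.neg_re] at this
    exact mul_le_mul_of_nonneg_left this (Real.exp_pos _).le

/-- Test `h_M` on the index `N` when `y ≤ 0` and on `N + 2` when `y ≥ 0`: the leftover power is `exp
y`, resp. `exp (-y)`. Moderate growth reduces `M (N + 2)` to `M N`. -/
theorem exists_exp_mul_hFun_le (hM : StronglyRegular M) {K : ℝ} (hK : 0 < K) :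
    ∃ C D : ℝ, 0 < C ∧ 0 < D ∧ ∀ (N : ℕ) (y : ℝ),
      Real.exp y ^ (N + 1) * hFun M (K * Real.exp (-y)) ≤ C * D ^ N * M N * Real.exp (-|y|) := by
  obtain ⟨A, hA, hmg⟩ := hM.moderateGrowth
  have hM2 := hM.pos 2
  refine ⟨max 1 (A ^ 2 * K ^ 2 * M 2), K * max 1 A, by positivity, by positivity, fun N y => ?_⟩
  have hMN := hM.pos N
  have hle := fun p => hFun_le hM.pos (t := K * Real.exp (-y)) (by positivity) p
  have he : Real.exp y * Real.exp (-y) = 1 := by rw [← Real.exp_add]; simp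
  have hpow : ∀ n : ℕ, Real.exp y ^ n * Real.exp (-y) ^ n = 1 := fun n => by
    rw [← mul_pow, he, one_pow]
  rcases le_total y 0 with hy | hy
  · rw [abs_of_nonpos hy, neg_neg]
    calc _ ≤ Real.exp y ^ (N + 1) * (M N * (K * Real.exp (-y)) ^ N) :=
          mul_le_mul_of_nonneg_left (hle N) (by positivity)
      _ = (Real.exp y ^ N * Real.exp (-y) ^ N) * (1 * (K * 1) ^ N * M N * Real.exp y) := by ring
      _ ≤ _ := by
          rw [hpow, one_mul]
          gcongr <;> exact le_max_left _ _
  · rw [abs_of_nonneg hy]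
    have hmgN := hmg N 2
    calc _ ≤ Real.exp y ^ (N + 1) * (M (N + 2) * (K * Real.exp (-y)) ^ (N + 2)) :=
          mul_le_mul_of_nonneg_left (hle (N + 2)) (by positivity)
      _ ≤ Real.exp y ^ (N + 1) * ((A ^ (N + 2) * M N * M 2) * (K * Real.exp (-y)) ^ (N + 2)) := by
          gcongr
      _ = (Real.exp y ^ (N + 1) * Real.exp (-y) ^ (N + 1)) *
            ((A ^ 2 * K ^ 2 * M 2) * (K * A) ^ N * M N * Real.exp (-y)) := by ring
      _ ≤ _ := by
          rw [hpow, one_mul]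
          gcongr <;> exact le_max_right _ _

end Kernel

/-! ### Growth and Taylor remainders of `g`. -/

section BorelSide

variable {M : ℕ → ℝ} {d ε : ℝ} {g : ℂ → ℂ}

theorem sum_range_inv_two_pow_le (N : ℕ) : ∑ p ∈ Finset.range N, (1 / 2 : ℝ) ^ p ≤ 2 := by
  exact (summable_geometric_two.sum_le_tsum _ fun _ _ => by positivity).trans_eq
    tsum_geometric_two

theorem norm_hasSum_sub_sum_range_le {a : ℕ → ℂ} {l : ℂ} (ha : HasSum a l) {B q : ℝ}
    (hq : 0 ≤ q) (hq2 : q ≤ 1 / 2) (hb : ∀ p, ‖a p‖ ≤ B * q ^ p) (N : ℕ) :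
    ‖l - ∑ p ∈ Finset.range N, a p‖ ≤ 2 * B * q ^ N := by
  have hB : 0 ≤ B := by simpa using (norm_nonneg _).trans (hb 0)
  have h1 : HasSum (fun p => a (p + N)) (l - ∑ p ∈ Finset.range N, a p) :=
    (hasSum_nat_add_iff' N).2 ha
  rw [← h1.tsum_eq]
  have h2 := (hasSum_geometric_two).mul_left (B * q ^ N)
  refine (tsum_of_norm_bounded h2 fun p => ?_).trans_eq (by ring)
  calc ‖a (p + N)‖ ≤ B * q ^ (p + N) := hb _
    _ = (B * q ^ N) * q ^ p := by ring
    _ ≤ (B * q ^ N) * (1 / 2) ^ p := by gcongr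

theorem MemGrowthClass.exists_norm_le (hM : StronglyRegular M)
    (hpos : ∀ t, 0 < t → 0 < hFun M t) (hg : MemGrowthClass M d ε g)
    {b : ℝ} (hb0 : 0 ≤ b) (hb : b < ε * Real.pi / 2) (R : ℝ) (hR : 0 < R) :
    ∃ C k : ℝ, 0 < C ∧ 0 < k ∧ ∀ u : ℂ, |u.im - d| ≤ b → R ≤ Real.exp u.re →
      ‖g u‖ ≤ C / hFun M (k * Real.exp (-u.re)) := by
  have hpi := Real.pi_pos
  -- The growth hypothesis is used on the subsector of half-opening `b'`, which contains the closed
  -- strip; the bounded part left over is compact.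
  obtain ⟨b', hbb', hb'⟩ := exists_between hb
  obtain ⟨r, k₄, k₅, hr, hk₄, hk₅, hgr⟩ := hg.growth d (2 * b' / Real.pi)
    ⟨by have : 0 < b' := by linarith
        positivity, by field_simp; linarith, by field_simp; linarith⟩
  set S : Set ℂ := Set.Icc (Real.log R) (Real.log r) ×ℂ Set.Icc (d - b) (d + b) with hS
  have hScomp : IsCompact S := isCompact_Icc.reProdIm isCompact_Icc
  have hSsub : S ⊆ sector d ε := fun u hu => by
    have h2 := hu.2
    simp only [Set.mem_preimage, Set.mem_Icc] at h2
    rw [sector, Set.mem_ofPred_eq, abs_lt]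
    constructor <;> linarith [h2.1, h2.2]
  obtain ⟨C₁, hC₁⟩ := hScomp.exists_bound_of_continuousOn (hg.holomorphic.continuousOn.mono hSsub)
  refine ⟨max C₁ k₄, k₅, by positivity, hk₅, fun u hu hRu => ?_⟩
  have hk : 0 < k₅ * Real.exp (-u.re) := by positivity
  have hh := hpos _ hk
  rcases le_total r (Real.exp u.re) with hru | hru
  · refine (hgr u ?_ hru).trans ?_
    · rw [sector, Set.mem_ofPred_eq]
      field_simp
      linarith
    · rw [modulus, div_eq_mul_inv k₅, ← Real.exp_neg]
      gcongr
      exact le_max_right _ _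
  · have huS : u ∈ S := by
      refine ⟨⟨?_, ?_⟩, ?_⟩
      · rwa [Real.log_le_iff_le_exp hR]
      · rwa [Real.le_log_iff_exp_le hr]
      · rw [abs_le] at hu
        exact ⟨by linarith [hu.1], by linarith [hu.2]⟩
    have h1 : hFun M (k₅ * Real.exp (-u.re)) ≤ 1 := hFun_le_one hM.pos hM.zero hk.le
    calc ‖g u‖ ≤ C₁ := hC₁ u huS
      _ ≤ max C₁ k₄ := le_max_left _ _
      _ ≤ _ := le_div_self (by positivity) hh h1

/-- For `|u| < R / 4` the remainder is a geometric tail. Beyond, `(4|u|/R)^N ≥ 1`, so `g` and the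
partial sum can be bounded separately. -/
theorem MemGrowthClass.exists_norm_sub_sum_le (hM : StronglyRegular M)
    (hpos : ∀ t, 0 < t → 0 < hFun M t) (hg : MemGrowthClass M d ε g) (hε : 0 < ε)
    {c : ℕ → ℂ} {R : ℝ} (hR : 0 < R)
    (hsum : ∀ ζ ∈ boundedSector d ε R, HasSum (fun p => c p * Complex.exp ζ ^ p) (g ζ))
    {b : ℝ} (hb0 : 0 ≤ b) (hb : b < ε * Real.pi / 2) :
    ∃ C D k : ℝ, 0 < C ∧ 0 < D ∧ 0 < k ∧ ∀ (N : ℕ) (u : ℂ), |u.im - d| ≤ b →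
      ‖g u - ∑ p ∈ Finset.range N, c p * Complex.exp u ^ p‖ ≤
        C * D ^ N * Real.exp u.re ^ N / hFun M (k * Real.exp (-u.re)) := by
  have hexp : ∀ u : ℂ, ‖Complex.exp u‖ = Real.exp u.re := Complex.norm_exp
  -- The terms of the series converging at modulus `R / 2` are bounded.
  obtain ⟨B, hB0, hB⟩ : ∃ B : ℝ, 0 < B ∧ ∀ p, ‖c p‖ ≤ B * (2 / R) ^ p := by
    have hζ : (⟨Real.log (R / 2), d⟩ : ℂ) ∈ boundedSector d ε R := by
      refine ⟨?_, ?_⟩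
      · have := Real.pi_pos
        simp only [sector, Set.mem_ofPred_eq, sub_self, abs_zero]
        positivity
      · rw [modulus, Real.exp_log (by positivity)]
        linarith
    have htend := (hsum _ hζ).summable.tendsto_atTop_zero
    obtain ⟨B, hB⟩ := (Metric.isBounded_range_of_tendsto _ htend).exists_norm_le
    refine ⟨max B 1, by positivity, fun p => ?_⟩
    have h1 : ‖c p * Complex.exp ⟨Real.log (R / 2), d⟩ ^ p‖ ≤ B := hB _ ⟨p, rfl⟩
    rw [norm_mul, norm_pow, hexp, Real.exp_log (by positivity)] at h1
    have h2 : 0 < (R / 2) ^ p := by positivity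
    rw [← inv_div R 2, inv_pow, ← div_eq_mul_inv, le_div_iff₀ h2]
    exact h1.trans (le_max_left _ _)
  obtain ⟨C₁, k, hC₁, hk, hg₁⟩ := hg.exists_norm_le hM hpos hb0 hb (R / 4) (by positivity)
  refine ⟨C₁ + 2 * B, 4 / R, k, by positivity, by positivity, hk, fun N u hu => ?_⟩
  have hku : 0 < k * Real.exp (-u.re) := by positivity
  have hh := hpos _ hku
  have hh1 : hFun M (k * Real.exp (-u.re)) ≤ 1 := hFun_le_one hM.pos hM.zero hku.le
  have he := Real.exp_pos u.re
  have hterm : ∀ p, ‖c p * Complex.exp u ^ p‖ ≤ B * (2 / R * Real.exp u.re) ^ p := fun p => by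
    rw [norm_mul, norm_pow, hexp, mul_pow, ← mul_assoc]
    exact mul_le_mul_of_nonneg_right (hB p) (by positivity)
  rcases lt_or_ge (Real.exp u.re) (R / 4) with hlt | hge
  · have hmem : u ∈ boundedSector d ε R := ⟨hu.trans_lt hb, by rw [modulus]; linarith⟩
    have hq : 2 / R * Real.exp u.re ≤ 1 / 2 := by
      rw [div_mul_eq_mul_div, div_le_iff₀ hR]
      linarith
    refine (norm_hasSum_sub_sum_range_le (hsum u hmem) (by positivity) hq hterm N).trans ?_
    refine le_trans ?_ (le_div_self (by positivity) hh hh1)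
    rw [mul_assoc (C₁ + 2 * B), ← mul_pow]
    gcongr
    · linarith
    · norm_num
  · have hone : 1 ≤ 4 / R * Real.exp u.re := by
      rw [div_mul_eq_mul_div, le_div_iff₀ hR]
      linarith
    set Q := 4 / R * Real.exp u.re with hQ
    have hQN : 1 ≤ Q ^ N := one_le_pow₀ hone
    have hsumle : ‖∑ p ∈ Finset.range N, c p * Complex.exp u ^ p‖ ≤ 2 * B * Q ^ N := by
      calc _ ≤ ∑ p ∈ Finset.range N, B * Q ^ N * (1 / 2) ^ p := by
            refine norm_sum_le_of_le _ fun p hp => (hterm p).trans ?_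
            have hQp : Q ^ p ≤ Q ^ N := pow_le_pow_right₀ hone (Finset.mem_range.1 hp).le
            calc B * (2 / R * Real.exp u.re) ^ p = B * Q ^ p * (1 / 2) ^ p := by
                  rw [hQ, mul_assoc, ← mul_pow]; ring
              _ ≤ _ := by gcongr
        _ ≤ B * Q ^ N * 2 := by
            rw [← Finset.mul_sum]
            exact mul_le_mul_of_nonneg_left (sum_range_inv_two_pow_le N) (by positivity)
        _ = _ := by ring
    calc _ ≤ ‖g u‖ + ‖∑ p ∈ Finset.range N, c p * Complex.exp u ^ p‖ := norm_sub_le _ _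
      _ ≤ C₁ * Q ^ N / hFun M (k * Real.exp (-u.re)) +
          2 * B * Q ^ N / hFun M (k * Real.exp (-u.re)) := by
          refine add_le_add ((hg₁ u hu hge).trans ?_)
            (hsumle.trans (le_div_self (by positivity) hh hh1))
          gcongr
          exact le_mul_of_one_le_right hC₁.le hQN
      _ = _ := by rw [hQ, mul_pow]; ring

end BorelSide

/-! ### The kernel against the remainders of `g`. -/

section KernelTimesRemainder

variable {M : ℕ → ℝ} {δ δ₁ s d ε : ℝ} {g : ℂ → ℂ}

theorem exists_norm_kernel_mul_sub_sum_le (hM : StronglyRegular M)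
    (hk : KernelParameters M δ δ₁ s) (hg : MemGrowthClass M d ε g) (hε : 0 < ε)
    {c : ℕ → ℂ} {R : ℝ} (hR : 0 < R)
    (hsum : ∀ ζ ∈ boundedSector d ε R, HasSum (fun p => c p * Complex.exp ζ ^ p) (g ζ))
    {b : ℝ} (hb0 : 0 ≤ b) (hb : b < ε * Real.pi / 2) :
    ∃ C D r : ℝ, 0 < C ∧ 0 < D ∧ 0 < r ∧ ∀ (N : ℕ) (u ζ : ℂ), |u.im - d| ≤ b →
      |u.im - ζ.im| < δ * Real.pi / 2 → modulus ζ < r →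
      ‖kernel M s (u - ζ) * (g u - ∑ p ∈ Finset.range N, c p * Complex.exp u ^ p)‖ ≤
        C * D ^ N * M N * modulus ζ ^ N * Real.exp (-|u.re - ζ.re|) := by
  obtain ⟨A, hA, hmg⟩ := hM.moderateGrowth
  obtain ⟨-, K, hK, hker⟩ := hk.exists_kernel_bound hM
  have hpos : ∀ t, 0 < t → 0 < hFun M t := fun t ht => hk.hFun_pos hM ht
  obtain ⟨C₁, D₁, k, hC₁, hD₁, hk0, hrem⟩ := hg.exists_norm_sub_sum_le hM hpos hε hR hsum hb0 hb
  obtain ⟨C₂, D₂, hC₂, hD₂, hexp⟩ := exists_exp_mul_hFun_le hM (mul_pos hA hK)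
  -- The radius is the one for which `A * K * |z/u| ≤ k / |u|`, that is, `h₁ ≤ h₂`.
  refine ⟨C₁ * C₂, D₁ * D₂, k / (A * K), by positivity, by positivity, by positivity,
    fun N u ζ hu huζ hζ => ?_⟩
  set y := u.re - ζ.re with hy
  have hkn := hker (u - ζ) (by simpa using huζ)
  rw [Complex.sub_re, ← hy] at hkn
  set h₁ := hFun M (A * K * Real.exp (-y)) with hh₁
  set h₂ := hFun M (k * Real.exp (-u.re)) with hh₂
  have h₁pos : 0 < h₁ := hpos _ (by positivity)
  have h₂pos : 0 < h₂ := hpos _ (by positivity)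
  have hsq : hFun M (K * Real.exp (-y)) ≤ h₁ ^ 2 := by
    rw [hh₁, mul_assoc]
    exact hFun_le_sq hM.pos hA hmg (by positivity)
  have h12 : h₁ ≤ h₂ := by
    refine hFun_mono hM.pos (by positivity) ?_
    rw [lt_div_iff₀ (by positivity), modulus] at hζ
    have : Real.exp (-y) = Real.exp ζ.re * Real.exp (-u.re) := by
      rw [← Real.exp_add, hy]; ring_nf
    rw [this, ← mul_assoc]
    exact mul_le_mul_of_nonneg_right (by linarith) (Real.exp_pos _).le
  have hu' : Real.exp u.re = Real.exp y * modulus ζ := by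
    rw [modulus, ← Real.exp_add, hy]; ring_nf
  have hmod : 0 < modulus ζ := Real.exp_pos _
  rw [norm_mul]
  calc _ ≤ (Real.exp y * h₁ ^ 2) * (C₁ * D₁ ^ N * Real.exp u.re ^ N / h₂) :=
        mul_le_mul (hkn.trans (mul_le_mul_of_nonneg_left hsq (Real.exp_pos _).le)) (hrem N u hu)
          (norm_nonneg _) (by positivity)
    _ = (C₁ * D₁ ^ N * modulus ζ ^ N) * (Real.exp y ^ (N + 1) * h₁) * (h₁ / h₂) := by
        rw [hu']; field_simp; ring
    _ ≤ (C₁ * D₁ ^ N * modulus ζ ^ N) * (Real.exp y ^ (N + 1) * h₁) * 1 := by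
        gcongr
        exact (div_le_one h₂pos).2 h12
    _ ≤ (C₁ * D₁ ^ N * modulus ζ ^ N) * (C₂ * D₂ ^ N * M N * Real.exp (-|y|)) := by
        rw [mul_one]
        exact mul_le_mul_of_nonneg_left (hexp N y) (by positivity)
    _ = _ := by rw [mul_pow D₁]; ring

theorem exists_norm_kernel_mul_exp_pow_le (hM : StronglyRegular M)
    (hk : KernelParameters M δ δ₁ s) (p : ℕ) :
    ∃ C : ℝ, ∀ v : ℂ, |v.im| < δ * Real.pi / 2 →
      ‖kernel M s v * Complex.exp v ^ p‖ ≤ C * Real.exp (-|v.re - 0|) := by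
  obtain ⟨-, K, hK, hker⟩ := hk.exists_kernel_bound hM
  obtain ⟨C, D, -, -, hexp⟩ := exists_exp_mul_hFun_le hM hK
  refine ⟨C * D ^ p * M p, fun v hv => ?_⟩
  rw [norm_mul, norm_pow, Complex.norm_exp, sub_zero]
  refine le_trans ?_ (hexp p v.re)
  calc _ ≤ (Real.exp v.re * hFun M (K * Real.exp (-v.re))) * Real.exp v.re ^ p :=
        mul_le_mul_of_nonneg_right (hker v hv) (by positivity)
    _ = _ := by ring

end KernelTimesRemainder

/-! ### Moments of the kernel. -/

section Moments

variable {M : ℕ → ℝ} {δ δ₁ s : ℝ}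

theorem moment_eq_integral (p : ℕ) :
    moment M s p = ∫ x : ℝ, kernel M s x * Complex.exp x ^ p := by
  rw [moment, integral_Ioi_eq_integral_exp]
  refine integral_congr_ae (Eventually.of_forall fun x => ?_)
  have hne : ((Real.exp x : ℝ) : ℂ) ≠ 0 := Complex.ofReal_ne_zero.2 (Real.exp_pos x).ne'
  simp only
  rw [Complex.cpow_sub _ _ hne, Complex.cpow_natCast, Complex.cpow_one, Real.log_exp,
    ← Complex.ofReal_exp]
  field_simp

theorem differentiableAt_kernel_mul_exp_pow
    (hd : ∀ v : ℂ, |v.im| < δ * Real.pi / 2 → DifferentiableAt ℂ (kernel M s) v) (p : ℕ) {v : ℂ}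
    (hv : |v.im| < δ * Real.pi / 2) :
    DifferentiableAt ℂ (fun v => kernel M s v * Complex.exp v ^ p) v :=
  (hd v hv).mul (by fun_prop)

theorem integrable_kernel_mul_exp_pow (hM : StronglyRegular M) (hk : KernelParameters M δ δ₁ s)
    (p : ℕ) {η : ℝ} (hη : |η| < δ * Real.pi / 2) :
    Integrable fun x : ℝ =>
      kernel M s (x + η * Complex.I) * Complex.exp (x + η * Complex.I) ^ p := by
  obtain ⟨C, hC⟩ := exists_norm_kernel_mul_exp_pow_le hM hk p
  exact integrable_of_norm_le_exp (φ := fun v => kernel M s v * Complex.exp v ^ p)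
    (fun u hu => differentiableAt_kernel_mul_exp_pow (hk.exists_kernel_bound hM).1 p (hu ▸ hη))
    (fun u hu => hC u (hu ▸ hη))

theorem integral_kernel_mul_exp_pow (hM : StronglyRegular M) (hk : KernelParameters M δ δ₁ s)
    (p : ℕ) {η : ℝ} (hη : |η| < δ * Real.pi / 2) :
    ∫ x : ℝ, kernel M s (x + η * Complex.I) * Complex.exp (x + η * Complex.I) ^ p =
      moment M s p := by
  obtain ⟨C, hC⟩ := exists_norm_kernel_mul_exp_pow_le hM hk p
  have him : ∀ u : ℂ, u.im ∈ Set.uIcc η 0 → |u.im| < δ * Real.pi / 2 := fun u hu => by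
    have := Set.abs_sub_le_of_uIcc_subset_uIcc (Set.uIcc_subset_uIcc_right hu)
    rw [zero_sub, zero_sub, abs_neg, abs_neg] at this
    exact this.trans_lt hη
  rw [integral_horizontal_eq (φ := fun v => kernel M s v * Complex.exp v ^ p) (b := 0)
    (fun u hu => differentiableAt_kernel_mul_exp_pow (hk.exists_kernel_bound hM).1 p (him u hu))
    (fun u hu => hC u (him u hu)), moment_eq_integral]
  simp

/-- The integrand is positive on the real axis. This makes the division in the formal Borel
transform genuine. -/
theorem moment_ne_zero (hM : StronglyRegular M) (hk : KernelParameters M δ δ₁ s) (p : ℕ) :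
    moment M s p ≠ 0 := by
  have hδ : |(0 : ℝ)| < δ * Real.pi / 2 := by
    have := Real.pi_pos
    have := hk.pos
    rw [abs_zero]; positivity
  have hint := integrable_kernel_mul_exp_pow hM hk p hδ
  choose k hk0 hkx using fun x => kernel_ofReal (M := M) s x
  have heq : ∀ x : ℝ, kernel M s (x + (0 : ℝ) * Complex.I) *
      Complex.exp (x + (0 : ℝ) * Complex.I) ^ p = ((k x * Real.exp x ^ p : ℝ) : ℂ) := fun x => by
    rw [Complex.ofReal_zero, zero_mul, add_zero, hkx]
    push_cast
    rfl
  rw [← integral_kernel_mul_exp_pow hM hk p hδ]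
  simp_rw [heq] at hint ⊢
  rw [integral_complex_ofReal, Complex.ofReal_ne_zero]
  have hpos : ∀ x, 0 < k x * Real.exp x ^ p := fun x => mul_pos (hk0 x) (by positivity)
  have hint' : Integrable fun x => k x * Real.exp x ^ p := hint.re
  refine ((integral_pos_iff_support_of_nonneg (fun x => (hpos x).le) hint').2 ?_).ne'
  have : Function.support (fun x => k x * Real.exp x ^ p) = Set.univ :=
    Set.eq_univ_of_forall fun x => (hpos x).ne'
  rw [this]
  simp

end Moments

/-! ### Convergence, gluing and expansion of Laplace transforms. -/

section LaplaceTransform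

variable {M : ℕ → ℝ} {δ δ₁ s d ε b r C D : ℝ} {g : ℂ → ℂ} {c : ℕ → ℂ}

theorem exp_mul_laplaceIntegrand_exp (τ : ℝ) (ζ : ℂ) (x : ℝ) :
    (Real.exp x : ℂ) * laplaceIntegrand M s τ g ζ (Real.exp x) =
      kernel M s (x + τ * Complex.I - ζ) * g (x + τ * Complex.I) := by
  have hne : ((Real.exp x : ℝ) : ℂ) ≠ 0 := Complex.ofReal_ne_zero.2 (Real.exp_pos x).ne'
  rw [laplaceIntegrand, Real.log_exp, mul_comm Complex.I]
  field_simp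

theorem laplaceTransform_eq_integral (τ : ℝ) (ζ : ℂ) :
    laplaceTransform M s τ g ζ =
      ∫ x : ℝ, kernel M s (x + τ * Complex.I - ζ) * g (x + τ * Complex.I) := by
  rw [laplaceTransform, integral_Ioi_eq_integral_exp]
  simp_rw [exp_mul_laplaceIntegrand_exp]

theorem integrableOn_laplaceIntegrand_iff (τ : ℝ) (ζ : ℂ) :
    IntegrableOn (laplaceIntegrand M s τ g ζ) (Set.Ioi 0) ↔
      Integrable fun x : ℝ => kernel M s (x + τ * Complex.I - ζ) * g (x + τ * Complex.I) := by
  rw [integrableOn_Ioi_iff_integrable_exp]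
  simp_rw [exp_mul_laplaceIntegrand_exp]

/-- The uniform estimate of the kernel against the remainders of the expansion of `g`, in the
closed strip of arguments `|arg u - d| ≤ b` and for `|z| < r`. -/
def KernelRemainderBound (M : ℕ → ℝ) (δ s d b r C D : ℝ) (g : ℂ → ℂ) (c : ℕ → ℂ) : Prop :=
  ∀ (N : ℕ) (u ζ : ℂ), |u.im - d| ≤ b → |u.im - ζ.im| < δ * Real.pi / 2 → modulus ζ < r →
    ‖kernel M s (u - ζ) * (g u - ∑ p ∈ Finset.range N, c p * Complex.exp u ^ p)‖ ≤
      C * D ^ N * M N * modulus ζ ^ N * Real.exp (-|u.re - ζ.re|)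

theorem KernelRemainderBound.norm_le (h : KernelRemainderBound M δ s d b r C D g c)
    (h0 : M 0 = 1) {u ζ : ℂ} (hu : |u.im - d| ≤ b) (huζ : |u.im - ζ.im| < δ * Real.pi / 2)
    (hζ : modulus ζ < r) :
    ‖kernel M s (u - ζ) * g u‖ ≤ C * Real.exp (-|u.re - ζ.re|) := by
  simpa [h0] using h 0 u ζ hu huζ hζ

theorem differentiableAt_kernel_mul (hM : StronglyRegular M) (hk : KernelParameters M δ δ₁ s)
    (hg : DifferentiableOn ℂ g (sector d ε)) {u ζ : ℂ} (hu : |u.im - d| < ε * Real.pi / 2)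
    (huζ : |u.im - ζ.im| < δ * Real.pi / 2) :
    DifferentiableAt ℂ (fun u => kernel M s (u - ζ) * g u) u := by
  have hopen : IsOpen (sector d ε) :=
    isOpen_lt (by fun_prop) continuous_const
  have h1 := (hk.exists_kernel_bound hM).1 (u - ζ) (by simpa using huζ)
  have h2 : DifferentiableAt ℂ (fun u : ℂ => u - ζ) u := by fun_prop
  exact (DifferentiableAt.comp u h1 h2).mul (hg.differentiableAt (hopen.mem_nhds hu))

theorem KernelRemainderBound.integrable (h : KernelRemainderBound M δ s d b r C D g c)
    (hM : StronglyRegular M) (hk : KernelParameters M δ δ₁ s)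
    (hg : DifferentiableOn ℂ g (sector d ε)) (hb : b < ε * Real.pi / 2) {τ : ℝ} {ζ : ℂ}
    (hτ : |τ - d| ≤ b) (hτζ : |τ - ζ.im| < δ * Real.pi / 2) (hζ : modulus ζ < r) :
    Integrable fun x : ℝ => kernel M s (x + τ * Complex.I - ζ) * g (x + τ * Complex.I) :=
  integrable_of_norm_le_exp (φ := fun u => kernel M s (u - ζ) * g u)
    (fun u hu => differentiableAt_kernel_mul hM hk hg (by rw [hu]; exact hτ.trans_lt hb)
      (by rwa [hu]))
    (fun u hu => h.norm_le hM.zero (by rwa [hu]) (by rwa [hu]) hζ)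

theorem abs_sub_le_max_of_mem_uIcc {a b x y : ℝ} (hx : x ∈ Set.uIcc a b) :
    |x - y| ≤ max |a - y| |b - y| := by
  rw [Set.mem_uIcc] at hx
  rcases hx with hx | hx
  · exact abs_le_max_abs_abs (by linarith [hx.1]) (by linarith [hx.2])
  · rw [max_comm]
    exact abs_le_max_abs_abs (by linarith [hx.1]) (by linarith [hx.2])

theorem KernelRemainderBound.laplaceTransform_eq (h : KernelRemainderBound M δ s d b r C D g c)
    (hM : StronglyRegular M) (hk : KernelParameters M δ δ₁ s)
    (hg : DifferentiableOn ℂ g (sector d ε)) (hb : b < ε * Real.pi / 2) {τ τ' : ℝ} {ζ : ℂ}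
    (hτ : |τ - d| ≤ b) (hτζ : |τ - ζ.im| < δ * Real.pi / 2)
    (hτ' : |τ' - d| ≤ b) (hτζ' : |τ' - ζ.im| < δ * Real.pi / 2) (hζ : modulus ζ < r) :
    laplaceTransform M s τ g ζ = laplaceTransform M s τ' g ζ := by
  rw [laplaceTransform_eq_integral, laplaceTransform_eq_integral]
  have h1 : ∀ u : ℂ, u.im ∈ Set.uIcc τ τ' → |u.im - d| ≤ b := fun u hu =>
    (abs_sub_le_max_of_mem_uIcc hu).trans (max_le hτ hτ')
  have h2 : ∀ u : ℂ, u.im ∈ Set.uIcc τ τ' → |u.im - ζ.im| < δ * Real.pi / 2 := fun u hu =>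
    (abs_sub_le_max_of_mem_uIcc hu).trans_lt (max_lt hτζ hτζ')
  exact integral_horizontal_eq (φ := fun u => kernel M s (u - ζ) * g u)
    (fun u hu => differentiableAt_kernel_mul hM hk hg ((h1 u hu).trans_lt hb) (h2 u hu))
    (fun u hu => h.norm_le hM.zero (h1 u hu) (h2 u hu) hζ)

theorem KernelRemainderBound.differentiableAt (h : KernelRemainderBound M δ s d b r C D g c)
    (hM : StronglyRegular M) (hk : KernelParameters M δ δ₁ s) (hC : 0 ≤ C)
    (hg : DifferentiableOn ℂ g (sector d ε)) (hb : b < ε * Real.pi / 2) {τ : ℝ} {ζ : ℂ}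
    (hτ : |τ - d| ≤ b) (hτζ : |τ - ζ.im| < δ * Real.pi / 2) (hζ : modulus ζ < r) :
    DifferentiableAt ℂ (laplaceTransform M s τ g) ζ := by
  have hopen : IsOpen {ζ : ℂ | |τ - ζ.im| < δ * Real.pi / 2 ∧ modulus ζ < r} := by
    have h1 : Continuous fun ζ : ℂ => |τ - ζ.im| := by fun_prop
    have h2 : Continuous modulus := by unfold modulus; fun_prop
    exact (isOpen_lt h1 continuous_const).inter (isOpen_lt h2 continuous_const)
  obtain ⟨η, hη, hball⟩ := Metric.isOpen_iff.1 hopen ζ ⟨hτζ, hζ⟩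
  have hball' : Metric.ball ζ (min η 1) ⊆ {ζ : ℂ | |τ - ζ.im| < δ * Real.pi / 2 ∧ modulus ζ < r} :=
    (Metric.ball_subset_ball (min_le_left _ _)).trans hball
  have heq : laplaceTransform M s τ g = fun ζ =>
      ∫ x : ℝ, kernel M s (x + τ * Complex.I - ζ) * g (x + τ * Complex.I) :=
    funext fun ζ => laplaceTransform_eq_integral τ ζ
  rw [heq]
  -- Moving the centre of `exp (-|x - z.re|)` by less than 1 costs a factor `exp 1`.
  refine differentiableAt_integral_of_norm_le (r := min η 1)
    (B := fun x => C * Real.exp 1 * Real.exp (-|x - ζ.re|)) (by positivity)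
    (fun z hz => (h.integrable hM hk hg hb hτ (hball' hz).1 (hball' hz).2).aestronglyMeasurable)
    (fun x z hz => ?_) (fun x z hz => ?_) ((integrable_exp_neg_abs_sub _).const_mul _)
  · have h1 := (hk.exists_kernel_bound hM).1 (x + τ * Complex.I - z) (by
      simpa using (hball' hz).1)
    have h2 : DifferentiableAt ℂ (fun z : ℂ => x + τ * Complex.I - z) z := by fun_prop
    exact ((DifferentiableAt.comp z h1 h2).mul_const _).differentiableWithinAt
  · have h1 := h.norm_le hM.zero (u := x + τ * Complex.I) (ζ := z) (by simpa using hτ)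
      (by simpa using (hball' hz).1) (hball' hz).2
    refine h1.trans ?_
    rw [mul_assoc, ← Real.exp_add]
    refine mul_le_mul_of_nonneg_left (Real.exp_le_exp.2 ?_) hC
    have h3 : |z.re - ζ.re| < 1 := by
      rw [Metric.mem_ball, dist_eq_norm] at hz
      have := Complex.abs_re_le_norm (z - ζ)
      rw [Complex.sub_re] at this
      exact this.trans_lt (hz.trans_le (min_le_right _ _))
    have h4 := abs_sub_le x z.re ζ.re
    simp only [Complex.add_re, Complex.ofReal_re, Complex.mul_re, Complex.I_re, mul_zero,
      Complex.ofReal_im, Complex.I_im, mul_one, sub_self, add_zero]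
    linarith [abs_sub_comm x z.re]

theorem kernel_mul_exp_pow_eq (τ : ℝ) (ζ : ℂ) (p : ℕ) (x : ℝ) :
    kernel M s (x + τ * Complex.I - ζ) * Complex.exp (x + τ * Complex.I) ^ p =
      Complex.exp ζ ^ p * (kernel M s ((x - ζ.re : ℝ) + (τ - ζ.im : ℝ) * Complex.I) *
        Complex.exp ((x - ζ.re : ℝ) + (τ - ζ.im : ℝ) * Complex.I) ^ p) := by
  have h1 : ((x - ζ.re : ℝ) : ℂ) + (τ - ζ.im : ℝ) * Complex.I = x + τ * Complex.I - ζ := by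
    apply Complex.ext <;> simp
  rw [h1, Complex.exp_sub, div_pow]
  have := Complex.exp_ne_zero ζ
  field_simp

/-- Translating by `ζ` and shifting the contour turns the transform of `u ^ p` into `m(p) z^p`. What
remains is the integral of the kernel times the remainder; the 2 is `∫ exp (-|x|)`. -/
theorem KernelRemainderBound.norm_laplaceTransform_sub_sum_le
    (h : KernelRemainderBound M δ s d b r C D g c)
    (hM : StronglyRegular M) (hk : KernelParameters M δ δ₁ s)
    (hg : DifferentiableOn ℂ g (sector d ε)) (hb : b < ε * Real.pi / 2) {τ : ℝ} {ζ : ℂ}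
    (hτ : |τ - d| ≤ b) (hτζ : |τ - ζ.im| < δ * Real.pi / 2) (hζ : modulus ζ < r) (N : ℕ) :
    ‖laplaceTransform M s τ g ζ -
        ∑ p ∈ Finset.range N, c p * moment M s p * Complex.exp ζ ^ p‖ ≤
      2 * C * D ^ N * M N * modulus ζ ^ N := by
  have hint := h.integrable hM hk hg hb hτ hτζ hζ
  have hmon : ∀ p, Integrable fun x : ℝ =>
      kernel M s (x + τ * Complex.I - ζ) * Complex.exp (x + τ * Complex.I) ^ p := fun p => by
    rw [funext (kernel_mul_exp_pow_eq τ ζ p)]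
    exact ((integrable_kernel_mul_exp_pow hM hk p hτζ).comp_sub_right ζ.re).const_mul _
  have hmom : ∀ p : ℕ, ∫ x : ℝ,
      kernel M s (x + τ * Complex.I - ζ) * Complex.exp (x + τ * Complex.I) ^ p =
        moment M s p * Complex.exp ζ ^ p := fun p => by
    rw [funext (kernel_mul_exp_pow_eq τ ζ p), integral_const_mul, integral_sub_right_eq_self (fun x : ℝ =>
      kernel M s (x + (τ - ζ.im : ℝ) * Complex.I) *
        Complex.exp (x + (τ - ζ.im : ℝ) * Complex.I) ^ p), integral_kernel_mul_exp_pow hM hk p hτζ,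
      mul_comm]
  have hsum : ∑ p ∈ Finset.range N, c p * moment M s p * Complex.exp ζ ^ p =
      ∫ x : ℝ, ∑ p ∈ Finset.range N, c p *
        (kernel M s (x + τ * Complex.I - ζ) * Complex.exp (x + τ * Complex.I) ^ p) := by
    rw [integral_finsetSum _ fun p _ => (hmon p).const_mul _]
    simp_rw [integral_const_mul, hmom, mul_assoc]
  rw [laplaceTransform_eq_integral, hsum,
    ← integral_sub hint (integrable_finsetSum _ fun p _ => (hmon p).const_mul _)]
  refine (norm_integral_le_of_norm_le ((integrable_exp_neg_abs_sub ζ.re).const_mul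
    (C * D ^ N * M N * modulus ζ ^ N)) (Eventually.of_forall fun x => ?_)).trans_eq ?_
  · have := h N (x + τ * Complex.I) ζ (by simpa using hτ) (by simpa using hτζ) hζ
    rw [mul_sub, Finset.mul_sum] at this
    simp_rw [mul_left_comm] at this
    simpa using this
  · rw [integral_const_mul, integral_exp_neg_abs_sub]
    ring

end LaplaceTransform

/-! ### From remainders to derivatives. -/

section Derivatives

variable {f : ℂ → ℂ} {U : Set ℂ}

theorem differentiableOn_zDeriv_iterate (hU : IsOpen U) (hf : DifferentiableOn ℂ f U) (p : ℕ) :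
    DifferentiableOn ℂ (zDeriv^[p] f) U := by
  induction p with
  | zero => exact hf
  | succ p ih =>
    rw [Function.iterate_succ_apply']
    exact DifferentiableOn.mul (by fun_prop) (ih.deriv hU)

/-- Through a local logarithm `Lg`, `f` becomes a function on the disc of radius `ρ * ‖z₀‖` about
`z₀`. The `p`-th derivative kills the polynomial of degree below `p`, so Cauchy's estimate applies
to the remainder. The `3 / 2` comes from `|log (1 + w)| ≤ 3/2 * |w|`. -/
theorem norm_zDeriv_iterate_le (hU : IsOpen U) (hf : DifferentiableOn ℂ f U) {a : ℕ → ℂ}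
    {p : ℕ} {B ρ : ℝ} (hB : 0 ≤ B)
    (hrem : ∀ ζ ∈ U, ‖f ζ - ∑ k ∈ Finset.range p, a k * Complex.exp ζ ^ k‖ ≤ B * modulus ζ ^ p)
    (hρ : 0 < ρ) (hρ2 : ρ ≤ 1 / 2) {ζ₀ : ℂ} (hball : Metric.closedBall ζ₀ (3 / 2 * ρ) ⊆ U) :
    ‖(zDeriv^[p] f) ζ₀‖ ≤ p.factorial * (B * (2 / ρ) ^ p) := by
  set z₀ := Complex.exp ζ₀ with hz₀
  have hz₀0 : z₀ ≠ 0 := Complex.exp_ne_zero _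
  have hz₀n : 0 < ‖z₀‖ := norm_pos_iff.2 hz₀0
  set Lg : ℂ → ℂ := fun z => ζ₀ + Complex.log (z / z₀) with hLg
  have hw : ∀ z ∈ Metric.closedBall z₀ (ρ * ‖z₀‖), ‖z / z₀ - 1‖ ≤ ρ := fun z hz => by
    rw [Metric.mem_closedBall, dist_eq_norm] at hz
    rwa [div_sub_one hz₀0, norm_div, div_le_iff₀ hz₀n]
  have hslit : ∀ z ∈ Metric.closedBall z₀ (ρ * ‖z₀‖), z / z₀ ∈ Complex.slitPlane := fun z hz => by
    have := Complex.mem_slitPlane_of_norm_lt_one ((hw z hz).trans_lt (by linarith))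
    rwa [add_sub_cancel] at this
  have hne : ∀ z ∈ Metric.closedBall z₀ (ρ * ‖z₀‖), z / z₀ ≠ 0 := fun z hz =>
    Complex.slitPlane_ne_zero (hslit z hz)
  have hexp : ∀ z ∈ Metric.closedBall z₀ (ρ * ‖z₀‖), Complex.exp (Lg z) = z := fun z hz => by
    rw [hLg, Complex.exp_add, Complex.exp_log (hne z hz), ← hz₀, mul_div_cancel₀ _ hz₀0]
  have hLgU : ∀ z ∈ Metric.closedBall z₀ (ρ * ‖z₀‖), Lg z ∈ U := fun z hz => by
    refine hball ?_
    have h1 := Complex.norm_log_one_add_half_le_self ((hw z hz).trans hρ2)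
    rw [add_sub_cancel] at h1
    rw [Metric.mem_closedBall, dist_eq_norm, hLg, add_sub_cancel_left]
    linarith [hw z hz]
  have hLgd : ∀ z ∈ Metric.closedBall z₀ (ρ * ‖z₀‖), HasDerivAt Lg z⁻¹ z := fun z hz => by
    have h1 := (((hasDerivAt_id z).div_const z₀).clog (hslit z hz)).const_add ζ₀
    refine h1.congr_deriv ?_
    have : z ≠ 0 := fun h => hne z hz (by simp [h])
    rw [id]
    field_simp
  have hcomp : ∀ k, ∀ z ∈ Metric.closedBall z₀ (ρ * ‖z₀‖),
      HasDerivAt (zDeriv^[k] f ∘ Lg) ((zDeriv^[k + 1] f) (Lg z)) z := fun k z hz => by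
    have h1 := ((differentiableOn_zDeriv_iterate hU hf k).differentiableAt
      (hU.mem_nhds (hLgU z hz))).hasDerivAt.comp z (hLgd z hz)
    refine h1.congr_deriv ?_
    rw [Function.iterate_succ_apply', zDeriv, Complex.exp_neg, hexp z hz, mul_comm]
  have hiter : ∀ k, ∀ z ∈ Metric.ball z₀ (ρ * ‖z₀‖),
      iteratedDeriv k (f ∘ Lg) z = (zDeriv^[k] f) (Lg z) := fun k => by
    induction k with
    | zero => intro z _; simp
    | succ k ih =>
      intro z hz
      rw [iteratedDeriv_succ]
      have hev : iteratedDeriv k (f ∘ Lg) =ᶠ[𝓝 z] zDeriv^[k] f ∘ Lg := by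
        filter_upwards [Metric.isOpen_ball.mem_nhds hz] with y hy using ih y hy
      rw [hev.deriv_eq]
      exact (hcomp k z (Metric.ball_subset_closedBall hz)).deriv
  have hR : 0 < ρ * ‖z₀‖ := by positivity
  have hdiff : DifferentiableOn ℂ (f ∘ Lg) (Metric.closedBall z₀ (ρ * ‖z₀‖)) := fun z hz =>
    (hcomp 0 z hz).differentiableAt.differentiableWithinAt
  set P : ℂ → ℂ := fun z => ∑ k ∈ Finset.range p, a k * z ^ k with hP
  have hPd : Differentiable ℂ P := by fun_prop
  have hP0 : iteratedDeriv p P z₀ = 0 := by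
    rw [hP, iteratedDeriv_fun_sum fun k _ => by fun_prop]
    refine Finset.sum_eq_zero fun k hk => ?_
    rw [iteratedDeriv_const_mul_field, iteratedDeriv_pow,
      Nat.descFactorial_eq_zero_iff_lt.2 (Finset.mem_range.1 hk)]
    simp
  have hz₀b : z₀ ∈ Metric.ball z₀ (ρ * ‖z₀‖) := Metric.mem_ball_self hR
  have hLg0 : Lg z₀ = ζ₀ := by simp [hLg, div_self hz₀0]
  have hkey : iteratedDeriv p (fun z => (f ∘ Lg) z - P z) z₀ = (zDeriv^[p] f) ζ₀ := by
    have hfa : ContDiffAt ℂ p (f ∘ Lg) z₀ :=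
      ((hdiff.mono Metric.ball_subset_closedBall).analyticAt
        (Metric.isOpen_ball.mem_nhds hz₀b)).contDiffAt
    rw [iteratedDeriv_fun_sub hfa hPd.contDiff.contDiffAt, hP0, sub_zero, hiter p z₀ hz₀b, hLg0]
  rw [← hkey]
  have hmod : modulus ζ₀ = ‖z₀‖ := by rw [hz₀, Complex.norm_exp, modulus]
  refine (Complex.norm_iteratedDeriv_le_of_forall_mem_sphere_norm_le p hR
    (C := B * (2 * ‖z₀‖) ^ p) ?_ fun z hz => ?_).trans_eq ?_
  · exact ((hdiff.sub hPd.differentiableOn).mono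
      Metric.closure_ball_subset_closedBall).diffContOnCl
  · have hzc := Metric.sphere_subset_closedBall hz
    have h1 := hrem (Lg z) (hLgU z hzc)
    rw [hexp z hzc] at h1
    refine h1.trans ?_
    have h2 : modulus (Lg z) ≤ 2 * ‖z₀‖ := by
      rw [modulus, ← Complex.norm_exp, hexp z hzc]
      rw [Metric.mem_closedBall, dist_eq_norm] at hzc
      nlinarith [norm_le_norm_add_norm_sub' z z₀]
    exact mul_le_mul_of_nonneg_left (pow_le_pow_left₀ (Real.exp_pos _).le h2 p) hB
  · rw [mul_pow, mul_pow, div_pow]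
    field_simp

end Derivatives

/-! ### Bounded sectors as sectorial regions. -/

section Sectors

theorem isOpen_boundedSector (d β ρ : ℝ) : IsOpen (boundedSector d β ρ) := by
  have h1 : Continuous fun ζ : ℂ => |ζ.im - d| := by fun_prop
  have h2 : Continuous modulus := by unfold modulus; fun_prop
  exact (isOpen_lt h1 continuous_const).inter (isOpen_lt h2 continuous_const)

theorem boundedSector_eq_reProdIm (d β : ℝ) {ρ : ℝ} (hρ : 0 < ρ) :
    boundedSector d β ρ = Set.Iio (Real.log ρ) ×ℂ
      Set.Ioo (d - β * Real.pi / 2) (d + β * Real.pi / 2) := by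
  ext ζ
  simp only [boundedSector, sector, modulus, Set.mem_ofPred_eq, Complex.mem_reProdIm, Set.mem_Iio,
    Set.mem_Ioo, Real.lt_log_iff_exp_lt hρ, abs_lt]
  constructor
  · rintro ⟨⟨h1, h2⟩, h3⟩
    exact ⟨h3, by linarith, by linarith⟩
  · rintro ⟨h3, h1, h2⟩
    exact ⟨⟨by linarith, by linarith⟩, h3⟩

theorem isSectorialRegion_boundedSector (d : ℝ) {β ρ : ℝ} (hβ : 0 < β) (hρ : 0 < ρ) :
    IsSectorialRegion (boundedSector d β ρ) d β where
  isOpen := isOpen_boundedSector d β ρ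
  isConnected := by
    have hpi := Real.pi_pos
    refine Convex.isConnected ?_ ⟨⟨Real.log ρ - 1, d⟩, ?_⟩
    · rw [boundedSector_eq_reProdIm d β hρ]
      exact (convex_halfSpace_re_lt _).inter
        ((convex_halfSpace_im_gt _).inter (convex_halfSpace_im_lt _))
    · rw [boundedSector_eq_reProdIm d β hρ]
      have : 0 < β * Real.pi / 2 := by positivity
      exact ⟨by simp, by simpa using this⟩
  subset := fun ζ hζ => hζ.1
  exists_radius := fun β' _ hβ' => ⟨ρ, hρ, fun ζ hζ => ⟨lt_trans hζ.1 (by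
    change β' * Real.pi / 2 < β * Real.pi / 2
    have := mul_lt_mul_of_pos_right hβ' Real.pi_pos
    linarith), hζ.2⟩⟩

theorem closedBall_subset_boundedSector {d β β' r η : ℝ} (hη : η ≤ (β' - β) * Real.pi / 2)
    {ζ : ℂ} (hζ : ζ ∈ boundedSector d β (r * Real.exp (-η))) :
    Metric.closedBall ζ η ⊆ boundedSector d β' r := fun z hz => by
  rw [Metric.mem_closedBall, dist_eq_norm] at hz
  have h1 := (Complex.abs_re_le_norm (z - ζ)).trans hz
  have h2 := (Complex.abs_im_le_norm (z - ζ)).trans hz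
  rw [Complex.sub_re] at h1
  rw [Complex.sub_im] at h2
  obtain ⟨h3, h4⟩ := hζ
  simp only [sector, Set.mem_ofPred_eq] at h3
  refine ⟨?_, ?_⟩
  · simp only [sector, Set.mem_ofPred_eq]
    linarith [abs_sub_le z.im ζ.im d]
  · rw [modulus] at h4 ⊢
    calc Real.exp z.re ≤ Real.exp ζ.re * Real.exp η := by
          rw [← Real.exp_add]
          exact Real.exp_le_exp.2 (by linarith [(abs_le.1 h1).2])
      _ < r * Real.exp (-η) * Real.exp η := by gcongr
      _ = r := by rw [mul_assoc, ← Real.exp_add]; simp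

end Sectors

end MSummability

/-! ### Gluing the transforms into the sum. -/

theorem mainTheorem5 (M : ℕ → ℝ) (hM : MSummability.StronglyRegular M)
    (δ δ₁ s d ε : ℝ) (F : PowerSeries ℂ) (g : ℂ → ℂ)
    (hF : MSummability.MSummable M δ δ₁ s d ε F g)
    (hδε : MSummability.growthIndex M < δ + ε) :
    ∃ (β : ℝ) (G : Set ℂ) (f : ℂ → ℂ),
      MSummability.growthIndex M < β ∧
      MSummability.IsSectorialRegion G d β ∧
      MSummability.MemUltraholomorphic M G f ∧
      MSummability.IsLaplaceTransformIn M δ s d ε g G f ∧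
      MSummability.AsymptoticIn M G f F := by
  open MSummability in
  have hpi := Real.pi_pos
  have hk := hF.kernelParameters
  have hδ := hk.pos
  have hε := hF.eps_pos
  have hg := hF.memGrowthClass
  obtain ⟨R, hR, hsum⟩ := hF.continuation
  have hγ : 0 < growthIndex M := (hk.pos.trans hk.lt).trans hk.lt_growthIndex
  -- `f` is built on the opening `β'`; the smaller `β` leaves room for the Cauchy discs.
  obtain ⟨β', hγβ', hβ'⟩ := exists_between hδε
  obtain ⟨β, hγβ, hββ'⟩ := exists_between hγβ'
  set c : ℕ → ℂ := fun p => PowerSeries.coeff p (formalBorel M s F) with hc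
  have hcm : ∀ p, c p * moment M s p = PowerSeries.coeff p F := fun p => by
    simp only [hc, formalBorel, PowerSeries.coeff_mk]
    exact div_mul_cancel₀ _ (moment_ne_zero hM hk p)
  -- The deviation of `arg z` from `d` is split in the ratio `ε : δ` between turning the ray and the
  -- aperture of the kernel; both shares fit because `β' < δ + ε`.
  set κ : ℝ := ε / (δ + ε) with hκ
  have hδε0 : 0 < δ + ε := by positivity
  have hκ0 : 0 < κ := by positivity
  have hκ1 : 0 < 1 - κ := by
    rw [hκ, one_sub_div hδε0.ne', add_sub_cancel_right]
    positivity
  have hκε : κ * β' < ε := by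
    rw [hκ, div_mul_eq_mul_div, div_lt_iff₀ hδε0]
    gcongr
  have hκδ : (1 - κ) * β' < δ := by
    rw [hκ, one_sub_div hδε0.ne', add_sub_cancel_right, div_mul_eq_mul_div, div_lt_iff₀ hδε0]
    gcongr
  set b : ℝ := κ * β' * Real.pi / 2 with hb
  have hβ'0 : 0 < β' := hγ.trans hγβ'
  have hb0 : 0 ≤ b := by positivity
  have hbε : b < ε * Real.pi / 2 := by rw [hb]; gcongr
  obtain ⟨C, D, r, hC, hD, hr, hE⟩ :=
    exists_norm_kernel_mul_sub_sum_le hM hk hg hε hR hsum hb0 hbε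
  have hbound : KernelRemainderBound M δ s d b r C D g c := hE
  set τ : ℂ → ℝ := fun ζ => d + κ * (ζ.im - d) with hτ
  set U := boundedSector d β' r with hU
  have hUo : IsOpen U := isOpen_boundedSector d β' r
  have hτd : ∀ ζ ∈ U, |τ ζ - d| ≤ b := fun ζ hζ => by
    have h1 : |ζ.im - d| < β' * Real.pi / 2 := hζ.1
    rw [hτ, add_sub_cancel_left, abs_mul, abs_of_pos hκ0, hb, mul_assoc, mul_div_assoc]
    rw [mul_div_assoc] at h1 ⊢
    nlinarith
  have hτζ : ∀ ζ ∈ U, |τ ζ - ζ.im| < δ * Real.pi / 2 := fun ζ hζ => by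
    have h1 : |ζ.im - d| < β' * Real.pi / 2 := hζ.1
    have h2 : τ ζ - ζ.im = -((1 - κ) * (ζ.im - d)) := by rw [hτ]; ring
    rw [h2, abs_neg, abs_mul, abs_of_pos hκ1]
    calc (1 - κ) * |ζ.im - d| ≤ (1 - κ) * (β' * Real.pi / 2) := by gcongr
      _ = (1 - κ) * β' * (Real.pi / 2) := by ring
      _ < δ * (Real.pi / 2) := by gcongr
      _ = _ := by ring
  set f : ℂ → ℂ := fun ζ => laplaceTransform M s (τ ζ) g ζ with hf
  have hfd : DifferentiableOn ℂ f U := fun ζ hζ => by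
    have h1 := hbound.differentiableAt hM hk hC.le hg.holomorphic hbε (hτd ζ hζ) (hτζ ζ hζ) hζ.2
    -- Near `ζ` the moving direction `τ z` can be frozen at `τ ζ`.
    refine (h1.congr_of_eventuallyEq ?_).differentiableWithinAt
    have hcont : Continuous fun z : ℂ => |τ ζ - z.im| := by fun_prop
    filter_upwards [hUo.mem_nhds hζ,
      (isOpen_lt hcont continuous_const).mem_nhds (hτζ ζ hζ)] with z hz hz'
    exact hbound.laplaceTransform_eq hM hk hg.holomorphic hbε (hτd z hz) (hτζ z hz)
      (hτd ζ hζ) hz' hz.2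
  have hfrem : ∀ (N : ℕ), ∀ ζ ∈ U,
      ‖f ζ - ∑ p ∈ Finset.range N, PowerSeries.coeff p F * Complex.exp ζ ^ p‖ ≤
        2 * C * D ^ N * M N * modulus ζ ^ N := fun N ζ hζ => by
    have := hbound.norm_laplaceTransform_sub_sum_le hM hk hg.holomorphic hbε (hτd ζ hζ)
      (hτζ ζ hζ) hζ.2 N
    simpa only [hcm] using this
  set ρ : ℝ := min (1 / 2) ((β' - β) * Real.pi / 3) with hρ
  have hρ0 : 0 < ρ := by
    have : 0 < β' - β := sub_pos.2 hββ'
    positivity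
  have hρ2 : ρ ≤ 1 / 2 := min_le_left _ _
  have hρ3 : 3 / 2 * ρ ≤ (β' - β) * Real.pi / 2 := by
    have : ρ ≤ (β' - β) * Real.pi / 3 := min_le_right _ _
    linarith
  have hball : ∀ ζ ∈ boundedSector d β (r * Real.exp (-(3 / 2 * ρ))),
      Metric.closedBall ζ (3 / 2 * ρ) ⊆ U := fun ζ hζ => closedBall_subset_boundedSector hρ3 hζ
  have hGU : boundedSector d β (r * Real.exp (-(3 / 2 * ρ))) ⊆ U := fun ζ hζ =>
    hball ζ hζ (Metric.mem_closedBall_self (by positivity))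
  refine ⟨β, boundedSector d β (r * Real.exp (-(3 / 2 * ρ))), f, hγβ,
    isSectorialRegion_boundedSector d (hγ.trans hγβ) (by positivity),
    ⟨hfd.mono hGU, D * (2 / ρ), 2 * C, by positivity, fun p ζ hζ => ?_⟩, ⟨fun ζ hζ => ?_,
    fun τ₀ hτ₀ => ?_⟩, fun T _ hT => ⟨D, 2 * C, hD, by positivity, fun N _ ζ hζ => ?_⟩⟩
  · have hMp := (hM.pos p).le
    refine (norm_zDeriv_iterate_le hUo hfd (by positivity) (hfrem p) hρ0 hρ2
      (hball ζ hζ)).trans_eq ?_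
    rw [mul_pow D]
    ring
  · have hζU := hGU hζ
    refine ⟨τ ζ, (hτd ζ hζU).trans_lt hbε, ?_, ?_, rfl⟩
    · have := hτζ ζ hζU
      rwa [abs_sub_comm] at this
    · rw [integrableOn_laplaceIntegrand_iff]
      exact hbound.integrable hM hk hg.holomorphic hbε (hτd ζ hζU) (hτζ ζ hζU) hζU.2
  -- The estimate is redone on a strip containing both `τ₀` and every `τ ζ`, so that the contour can
  -- be shifted between them.
  · have hb₁ : max b |τ₀ - d| < ε * Real.pi / 2 := max_lt hbε hτ₀
    obtain ⟨C₁, D₁, r₁, -, -, hr₁, hE₁⟩ :=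
      exists_norm_kernel_mul_sub_sum_le hM hk hg hε hR hsum (hb0.trans (le_max_left _ _)) hb₁
    have hbound₁ : KernelRemainderBound M δ s d (max b |τ₀ - d|) r₁ C₁ D₁ g c := hE₁
    refine ⟨r₁, hr₁, fun ζ hζ => ?_⟩
    have h1 : |τ₀ - ζ.im| < δ * Real.pi / 2 := by
      rw [abs_sub_comm]
      exact hζ.1
    refine ⟨?_, fun hζG => ?_⟩
    · rw [integrableOn_laplaceIntegrand_iff]
      exact hbound₁.integrable hM hk hg.holomorphic hb₁ (le_max_right _ _) h1 hζ.2
    · exact hbound₁.laplaceTransform_eq hM hk hg.holomorphic hb₁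
        ((hτd ζ (hGU hζG)).trans (le_max_left _ _)) (hτζ ζ (hGU hζG)) (le_max_right _ _) h1 hζ.2
  · exact hfrem N ζ (hGU (hT (subset_closure hζ)))
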